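/- All spaces $X$, $Z$ below used for testing extension properties are paracompact Hausdorff. For a CW-complex $L$, write $\text{e-dim}\,X\le[L]$ if every continuous map $A\to L$ from a closed subspace $A\subset X$ extends to a continuous map $X\to L$; write $[L]\le[L']$ if $\text{e-dim}\,X\le[L]$ implies $\text{e-dim}\,X\le[L']$ for every paracompact space $X$. A space $Y$ is in $ANE([L])$ if for every paracompact space $Z$ with $\text{e-dim}\,Z\le[L]$ and every closed $A\subset Z$, each continuous map $A\to Y$ extends continuously to some neighbourhood of $A$ in $Z$. A pair of subspaces $V\subset U$ of a space is $[L]$-connected if for every paracompact space $X$ with $\text{e-dim}\,X\le[L]$ and every closed $A\subset X$, each continuous map $A\to V$ extends to a continuous map $X\to U$. A pair of subspaces $K\subset K'$ of a space $Y$ is $UV^{[L]}$-connected in $Y$ if every neighbourhood $U$ of $K'$ in $Y$ contains a neighbourhood $V$ of $K$ in $Y$ such that the pair $V\subset U$ is $[L]$-connected. **Theorem.** Let $L$ be a CW-complex such that $[L]\le[S^n]$ for some integer $n\ge 0$, let $M$ be a compact space and $K\subset M$ a compact subset. Suppose that there are a Polish $ANE([L])$-space $B$ and an embedding $i\colon M\to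 B$ such that the pair $i(K)\subset i(M)$ is $UV^{[L]}$-connected in $B$. Then for every Polish $ANE([L])$-space $Y$ and every embedding $j\colon M\to Y$, the pair $j(K)\subset j(M)$ is $UV^{[L]}$-connected in $Y$. -/

import Mathlib

open Set Topology

universe u v w w'

/-- `e-dim X ≤ [L]`: every continuous map of a closed subspace `A ⊆ X` into `L` extends
continuously to all of `X`. -/
def ExtDimLE (X : Type u) [TopologicalSpace X] (L : Type v) [TopologicalSpace L] : Prop :=
  ∀ A : Set X, IsClosed A → ∀ f : C(A, L), ∃ g : C(X, L), ∀ a : A, g a = f a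

/-- `[L] ≤ [L']`: every paracompact (Hausdorff) space `X` with `e-dim X ≤ [L]` satisfies
`e-dim X ≤ [L']`. -/
def ExtTypeLE (L : Type u) [TopologicalSpace L] (L' : Type v) [TopologicalSpace L'] : Prop :=
  ∀ (X : Type u) [TopologicalSpace X] [T2Space X] [ParacompactSpace X],
    ExtDimLE X L → ExtDimLE X L'

/-- The pair of subspaces `V ⊆ U` of `Y` is `[L]`-connected: for every paracompact (Hausdorff)
space `X` with `e-dim X ≤ [L]` and every closed `A ⊆ X`, every continuous map `A → V` extends to
a continuous map `X → U`. -/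
def IsExtConnectedPair (L : Type u) [TopologicalSpace L] {Y : Type v} [TopologicalSpace Y]
    (V U : Set Y) : Prop :=
  V ⊆ U ∧
    ∀ (X : Type u) [TopologicalSpace X] [T2Space X] [ParacompactSpace X], ExtDimLE X L →
      ∀ A : Set X, IsClosed A → ∀ f : C(A, V), ∃ g : C(X, U), ∀ a : A, (g a : Y) = (f a : Y)

/-- The pair of subspaces `K ⊆ K'` of `Y` is `UV^[L]`-connected in `Y`: every neighbourhood `U`
of `K'` contains a neighbourhood `V` of `K` such that the pair `V ⊆ U` is `[L]`-connected. -/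
def IsUVConnectedPair (L : Type u) [TopologicalSpace L] {Y : Type v} [TopologicalSpace Y]
    (K K' : Set Y) : Prop :=
  K ⊆ K' ∧ ∀ U ∈ 𝓝ˢ K', ∃ V ∈ 𝓝ˢ K, IsExtConnectedPair L V U

/-- The map `f : Y → X` is locally `[L]`-soft: for every paracompact (Hausdorff) space `Z` with
`e-dim Z ≤ [L]`, every closed `A ⊆ Z`, and all continuous `g : Z → X`, `gA : A → Y` with
`f ∘ gA = g` on `A`, there are an open neighbourhood `O` of `A` and a continuous `g' : O → Y`
extending `gA` with `f ∘ g' = g` on `O`. -/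
def IsLocallyExtSoft (L : Type u) [TopologicalSpace L] {Y : Type v} {X : Type w}
    [TopologicalSpace Y] [TopologicalSpace X] (f : C(Y, X)) : Prop :=
  ∀ (Z : Type u) [TopologicalSpace Z] [T2Space Z] [ParacompactSpace Z], ExtDimLE Z L →
    ∀ A : Set Z, IsClosed A → ∀ (g : C(Z, X)) (gA : C(A, Y)), (∀ a : A, f (gA a) = g a) →
      ∃ (O : Set Z) (_ : IsOpen O) (hAO : A ⊆ O) (g' : C(O, Y)),
        (∀ z : O, f (g' z) = g z) ∧ ∀ a : A, g' (inclusion hAO a) = gA a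

/-- `Y ∈ ANE([L])`: the map of `Y` to a one-point space is locally `[L]`-soft. -/
def IsANE (L : Type u) [TopologicalSpace L] (Y : Type v) [TopologicalSpace Y] : Prop :=
  IsLocallyExtSoft L (ContinuousMap.const Y PUnit.unit.{1})

/-! The property passes through approximations: a map of a closed `A ⊆ X` into `Y` near `j(K)` is
carried to a map into `B` near `i(K)`, extended there over `X` with values near `i(M)`, and carried
back to `Y` so that it agrees with the given map on `A`. Carrying works because points near `j(M)`
can be replaced by nearby points of `M`, and the two embeddings induce uniformly equivalent metrics
on the compact space `M`.

What remains is to turn a discrete assignment (a finite open cover of `X` with one point of a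
compact set attached to each member) into a continuous map close to it, relative to `A`; this is
`IsANE.exists_extension_near_cover`. Since `[L] ≤ [S^n]`, the cover has a closed shrinking in which
no point lies in `n + 2` members (`ExtDimLE.exists_isClosed_cover`). The map is built by downward
induction on the number of members containing a point. Distinct `k`-fold intersections meet only
where the map is already defined, so each can be treated separately, using that small balls lie
`[L]`-connectedly in larger balls. As the number of steps depends only on `n`, the loss of closeness
is controlled.

That `ANE([L])` implies this local connectivity (`IsANE.exists_isExtConnectedPair_ball`) is seen by
gluing counterexamples into one space converging to a point at infinity and extending over a
neighbourhood of that point. The glued space must again have extension dimension at most `[L]`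
(`NullSequence.extDimLE`). Here the cell structure of `L` enters: near infinity a partial map takes
values in finitely many cells, which lie in a compact neighbourhood retract of a normed space. -/

/-! ### Extension properties phrased with total functions -/

theorem IsClosed.exists_continuousMap_eqOn {X : Type u} [TopologicalSpace X] [NormalSpace X]
    {E : Type v} [TopologicalSpace E] [TietzeExtension.{u, v} E] {A : Set X} (hA : IsClosed A) {f : X → E}
    (hf : ContinuousOn f A) : ∃ g : C(X, E), EqOn g f A := by
  obtain ⟨g, hg⟩ := ContinuousMap.exists_restrict_eq hA ⟨A.domRestrict f, hf.domRestrict⟩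
  exact ⟨g, fun x hx => DFunLike.congr_fun hg ⟨x, hx⟩⟩

theorem Topology.IsEmbedding.continuousOn_image {X Y Z : Type*} [TopologicalSpace X]
    [TopologicalSpace Y] [TopologicalSpace Z] {e : X → Y} (he : IsEmbedding e) {f : X → Z}
    {g : Y → Z} {B : Set X} (hf : ContinuousOn f B) (hg : ∀ x ∈ B, g (e x) = f x) :
    ContinuousOn g (e '' B) := by
  rintro _ ⟨b, hb, rfl⟩
  unfold ContinuousWithinAt
  rw [← he.map_nhdsWithin_eq, Filter.tendsto_map'_iff, hg b hb]
  exact (hf b hb).congr' (by filter_upwards [self_mem_nhdsWithin] with x hx using (hg x hx).symm)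

/-- Junk values off `A` let partial maps be restricted, composed and glued without subtypes. -/
theorem ContinuousMap.exists_continuousOn_eq {X Y : Type*} [TopologicalSpace X]
    [TopologicalSpace Y] [Nonempty Y] {A : Set X} (f : C(A, Y)) :
    ∃ g : X → Y, ContinuousOn g A ∧ ∀ a : A, g a = f a := by
  classical
  have h : ∀ a : A, Function.extend Subtype.val f (fun _ => Classical.arbitrary Y) a = f a :=
    fun a => Subtype.val_injective.extend_apply _ _ a
  refine ⟨_, ?_, h⟩
  have := IsEmbedding.subtypeVal.continuousOn_image (B := univ) f.continuous.continuousOn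
    (fun a _ => h a)
  simpa using this

theorem ExtDimLE.exists_eqOn {X : Type u} [TopologicalSpace X] {L : Type v} [TopologicalSpace L]
    (h : ExtDimLE X L) {A : Set X} (hA : IsClosed A) {f : X → L} (hf : ContinuousOn f A) :
    ∃ g : C(X, L), EqOn g f A := by
  obtain ⟨g, hg⟩ := h A hA ⟨A.domRestrict f, hf.domRestrict⟩
  exact ⟨g, fun x hx => hg ⟨x, hx⟩⟩

theorem ExtDimLE.of_exists_eqOn {X : Type u} [TopologicalSpace X] {L : Type v} [TopologicalSpace L]
    [Nonempty L] (h : ∀ A : Set X, IsClosed A → ∀ f : X → L, ContinuousOn f A →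
      ∃ g : C(X, L), EqOn g f A) : ExtDimLE X L := by
  intro A hA f
  obtain ⟨f', hf', hff'⟩ := f.exists_continuousOn_eq
  obtain ⟨g, hg⟩ := h A hA f' hf'
  exact ⟨g, fun a => (hg a.2).trans (hff' a)⟩

theorem ExtDimLE.subtype {X : Type u} [TopologicalSpace X] {L : Type v} [TopologicalSpace L]
    [Nonempty L] (h : ExtDimLE X L) {A : Set X} (hA : IsClosed A) : ExtDimLE A L := by
  refine .of_exists_eqOn fun B hB f hf => ?_
  have hext : ∀ a : A, Function.extend Subtype.val f (fun _ => Classical.arbitrary L) a = f a :=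
    fun a => Subtype.val_injective.extend_apply _ _ a
  obtain ⟨g, hg⟩ := h.exists_eqOn (hA.isClosedEmbedding_subtypeVal.isClosedMap _ hB)
    (IsEmbedding.subtypeVal.continuousOn_image hf fun a _ => hext a)
  refine ⟨g.comp ⟨Subtype.val, continuous_subtype_val⟩, fun a ha => ?_⟩
  exact (hg (mem_image_of_mem _ ha)).trans (hext a)

theorem ExtDimLE.isEmpty {X : Type u} [TopologicalSpace X] {L : Type v} [TopologicalSpace L]
    [IsEmpty L] (h : ExtDimLE X L) : IsEmpty X := by
  obtain ⟨g, -⟩ := h ∅ isClosed_empty ⟨fun a => a.2.elim, by fun_prop⟩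
  exact Function.isEmpty g

theorem IsExtConnectedPair.exists_eqOn {L : Type u} [TopologicalSpace L] {Y : Type v}
    [TopologicalSpace Y] {V U : Set Y} (h : IsExtConnectedPair L V U) {X : Type u}
    [TopologicalSpace X] [T2Space X] [ParacompactSpace X] (hX : ExtDimLE X L) {A : Set X}
    (hA : IsClosed A) {f : X → Y} (hf : ContinuousOn f A) (hV : MapsTo f A V) :
    ∃ g : C(X, Y), (∀ x, g x ∈ U) ∧ EqOn g f A := by
  obtain ⟨g, hg⟩ := h.2 X hX A hA ⟨_, hf.mapsToRestrict hV⟩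
  exact ⟨⟨fun x => g x, by fun_prop⟩, fun x => (g x).2, fun x hx => hg ⟨x, hx⟩⟩

theorem IsExtConnectedPair.of_exists_eqOn {L : Type u} [TopologicalSpace L] {Y : Type v}
    [TopologicalSpace Y] [Nonempty Y] {V U : Set Y} (hVU : V ⊆ U)
    (h : ∀ (X : Type u) [TopologicalSpace X] [T2Space X] [ParacompactSpace X], ExtDimLE X L →
      ∀ A : Set X, IsClosed A → ∀ f : X → Y, ContinuousOn f A → MapsTo f A V →
        ∃ g : C(X, Y), (∀ x, g x ∈ U) ∧ EqOn g f A) : IsExtConnectedPair L V U := by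
  refine ⟨hVU, fun X _ _ _ hX A hA f => ?_⟩
  obtain ⟨f', hf', hff'⟩ :=
    ContinuousMap.exists_continuousOn_eq (⟨fun a => f a, by fun_prop⟩ : C(A, Y))
  obtain ⟨g, hgU, hg⟩ := h X hX A hA f' hf'
    (fun a ha => by have := hff' ⟨a, ha⟩; simp only [ContinuousMap.coe_mk] at this
                    rw [this]; exact (f _).2)
  exact ⟨⟨fun x => ⟨g x, hgU x⟩, by fun_prop⟩, fun a => (hg a.2).trans (hff' a)⟩

theorem IsANE.exists_eqOn {L : Type u} [TopologicalSpace L] {Y : Type v} [TopologicalSpace Y]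
    (h : IsANE L Y) {Z : Type u} [TopologicalSpace Z] [T2Space Z] [ParacompactSpace Z]
    (hZ : ExtDimLE Z L) {A : Set Z} (hA : IsClosed A) {f : Z → Y} (hf : ContinuousOn f A) :
    ∃ (O : Set Z) (g : Z → Y), IsOpen O ∧ A ⊆ O ∧ ContinuousOn g O ∧ EqOn g f A := by
  obtain ⟨O, hO, hAO, g, -, hg⟩ := h Z hZ A hA (.const _ PUnit.unit) ⟨A.domRestrict f, hf.domRestrict⟩
    (fun _ => rfl)
  have hext : ∀ a : O, Function.extend Subtype.val g f a = g a :=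
    fun a => Subtype.val_injective.extend_apply _ _ a
  refine ⟨O, Function.extend Subtype.val g f, hO, hAO, ?_, fun a ha => ?_⟩
  · simpa using IsEmbedding.subtypeVal.continuousOn_image (B := univ) g.continuous.continuousOn
      (fun a _ => hext a)
  · exact (hext ⟨a, hAO ha⟩).trans (hg ⟨a, ha⟩)

/-! ### Covering dimension from extension of maps into spheres -/

/-- Push finitely many real functions away from their common zeros, without touching values of
absolute value at least `c`. -/
theorem ExtDimLE.exists_perturbation {X : Type u} [TopologicalSpace X] {n : ℕ}
    (h : ExtDimLE X (Metric.sphere (0 : EuclideanSpace ℝ (Fin (n + 1))) 1)) {ι : Type*}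
    (g : ι → C(X, ℝ)) {c : ℝ} (hc : 0 < c) (σ : Finset ι) (hσ : σ.card = n + 1) :
    ∃ g' : ι → C(X, ℝ), (∀ i x, c ≤ |g i x| → g' i x = g i x) ∧
      ∃ c' > 0, c' ≤ c ∧ ∀ x, ∃ i ∈ σ, c' ≤ |g' i x| := by
  classical
  let e := σ.equivFinOfCardEq hσ
  let v : X → EuclideanSpace ℝ (Fin (n + 1)) := fun x => WithLp.toLp 2 fun k => g (e.symm k) x
  have hv : Continuous v := by fun_prop
  have hA : IsClosed {x | c ≤ ‖v x‖} := isClosed_le continuous_const hv.norm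
  have hpos : ∀ a : {x | c ≤ ‖v x‖}, ‖v a‖ ≠ 0 := fun a => (hc.trans_le a.2).ne'
  obtain ⟨G, hG⟩ := h _ hA ⟨fun a => ⟨‖v a‖⁻¹ • v a, by
      rw [mem_sphere_zero_iff_norm, norm_smul, norm_inv, norm_norm, inv_mul_cancel₀ (hpos a)]⟩, by
    refine Continuous.subtype_mk (Continuous.smul (Continuous.inv₀ (by fun_prop) hpos)
      (by fun_prop)) _⟩
  -- The sphere-valued `G` extends the direction of `v`; the two branches agree where `‖v x‖ = c`,
  -- and the result has norm at least `c` everywhere.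
  let w' : X → EuclideanSpace ℝ (Fin (n + 1)) := fun x => if c ≤ ‖v x‖ then v x else c • (G x).1
  have hw' : Continuous w' := by
    refine Continuous.if_le hv (by fun_prop) continuous_const hv.norm fun x hx => ?_
    have := hG ⟨x, hx.le⟩
    rw [this]
    simp only [ContinuousMap.coe_mk]
    rw [← hx, smul_inv_smul₀ hc.ne']
  have hnorm : ∀ x, c ≤ ‖w' x‖ := by
    intro x
    by_cases hx : c ≤ ‖v x‖
    · simpa only [w', if_pos hx] using hx
    · simp only [w', if_neg hx, norm_smul, norm_eq_of_mem_sphere, Real.norm_eq_abs, abs_of_pos hc,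
        mul_one, le_refl]
  refine ⟨fun i => if hi : i ∈ σ then ⟨fun x => w' x (e ⟨i, hi⟩), by fun_prop⟩ else g i, ?_, ?_⟩
  · intro i x hx
    by_cases hi : i ∈ σ
    · have h1 : v x (e ⟨i, hi⟩) = g i x := by simp [v]
      have h2 : c ≤ ‖v x‖ := hx.trans (by
        rw [← h1, ← Real.norm_eq_abs]; exact PiLp.norm_apply_le _ _)
      simp only [dif_pos hi, ContinuousMap.coe_mk, w', if_pos h2, h1]
    · simp only [dif_neg hi]
  -- If all `n + 1` coordinates were below `c / (n + 1)`, the norm of `w' x` would be below `c`.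
  · refine ⟨c / (n + 1), by positivity, div_le_self hc.le (by simp), fun x => ?_⟩
    by_contra! hcon
    have hk : ∀ k, ‖w' x k‖ < c / (n + 1) := by
      intro k
      have := hcon (e.symm k) (e.symm k).2
      simpa [Real.norm_eq_abs] using this
    have h1 : ‖w' x‖ ^ 2 < c ^ 2 := by
      rw [EuclideanSpace.norm_sq_eq]
      calc ∑ k, ‖w' x k‖ ^ 2 < ∑ _k : Fin (n + 1), (c / (n + 1)) ^ 2 :=
            Finset.sum_lt_sum_of_nonempty Finset.univ_nonempty
              fun k _ => pow_lt_pow_left₀ (hk k) (norm_nonneg _) two_ne_zero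
        _ = c ^ 2 / (n + 1) := by
            rw [Finset.sum_const, Finset.card_univ, Fintype.card_fin, nsmul_eq_mul]
            push_cast; field_simp
        _ ≤ c ^ 2 := div_le_self (by positivity) (by simp)
    exact absurd (hnorm x) (not_le.2 (lt_of_pow_lt_pow_left₀ 2 hc.le h1))

/-- The sets are treated one at a time. Each perturbation fixes values of absolute value at least
the current `c`, so the bounds won for earlier sets survive. -/
theorem ExtDimLE.exists_perturbation_finset {X : Type u} [TopologicalSpace X] {n : ℕ}
    (h : ExtDimLE X (Metric.sphere (0 : EuclideanSpace ℝ (Fin (n + 1))) 1)) {ι : Type*}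
    (g : ι → C(X, ℝ)) (T : Finset (Finset ι)) (hT : ∀ σ ∈ T, σ.card = n + 1) :
    ∃ g' : ι → C(X, ℝ), (∀ i x, 1 ≤ |g i x| → g' i x = g i x) ∧
      ∃ c > 0, c ≤ 1 ∧ ∀ σ ∈ T, ∀ x, ∃ i ∈ σ, c ≤ |g' i x| := by
  classical
  induction T using Finset.induction_on with
  | empty => exact ⟨g, fun _ _ _ => rfl, 1, one_pos, le_rfl, by simp⟩
  | insert σ T _ ih =>
    obtain ⟨g₁, hg₁, c, hc, hc1, hcT⟩ := ih fun τ hτ => hT τ (Finset.mem_insert_of_mem hτ)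
    obtain ⟨g₂, hg₂, c', hc', hcc', hσ⟩ :=
      h.exists_perturbation g₁ hc σ (hT σ (Finset.mem_insert_self _ _))
    refine ⟨g₂, fun i x hx => ?_, c', hc', hcc'.trans hc1, fun τ hτ x => ?_⟩
    · rw [hg₂ i x (by rw [hg₁ i x hx]; exact hc1.trans hx), hg₁ i x hx]
    · rcases Finset.mem_insert.1 hτ with rfl | hτ
      · exact hσ x
      · obtain ⟨i, hi, hx⟩ := hcT τ hτ x
        exact ⟨i, hi, by rw [hg₂ i x hx]; exact hcc'.trans hx⟩

/-- A normal space whose maps to `S^n` extend has covering dimension at most `n`: finite open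
covers have closed shrinkings of order at most `n + 1`. -/
theorem ExtDimLE.exists_isClosed_cover {X : Type u} [TopologicalSpace X] [NormalSpace X] {n : ℕ}
    (h : ExtDimLE X (Metric.sphere (0 : EuclideanSpace ℝ (Fin (n + 1))) 1)) {ι : Type*}
    [Finite ι] (U : ι → Set X) (hU : ∀ i, IsOpen (U i)) (hcov : ⋃ i, U i = univ) :
    ∃ E : ι → Set X, (∀ i, IsClosed (E i)) ∧ (∀ i, E i ⊆ U i) ∧ (⋃ i, E i = univ) ∧
      ∀ σ : Finset ι, σ.card = n + 2 → ⋂ i ∈ σ, E i = ∅ := by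
  classical
  have := Fintype.ofFinite ι
  let _ : LinearOrder ι := LinearOrder.lift' (Fintype.equivFin ι) (Fintype.equivFin ι).injective
  obtain ⟨C, hCcov, hC, hCU⟩ := exists_iUnion_eq_closed_subset hU
    (fun x => Set.toFinite _) hcov
  -- The values `1` on `C i` and `-1` off `U i` are large enough to be left alone by the
  -- perturbation.
  have hury : ∀ i, ∃ f : C(X, ℝ), EqOn f 1 (C i) ∧ EqOn f (-1) (U i)ᶜ := by
    intro i
    obtain ⟨f, h0, h1, -⟩ := exists_continuous_zero_one_of_isClosed (hU i).isClosed_compl (hC i)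
      (disjoint_compl_left_iff_subset.2 (hCU i))
    refine ⟨⟨fun x => 2 * f x - 1, by fun_prop⟩, fun x hx => ?_, fun x hx => ?_⟩
    · simp [h1 hx]; norm_num
    · simp [h0 hx]
  choose g hg1 hg2 using hury
  obtain ⟨g', hg', c, hc, -, hT⟩ := h.exists_perturbation_finset g
    (Finset.univ.filter fun σ => σ.card = n + 1) (by simp)
  have hC' : ∀ i, ∀ x ∈ C i, g' i x = 1 := fun i x hx => by
    rw [hg' i x (by simp [hg1 i hx]), hg1 i hx]; rfl
  have hU' : ∀ i, ∀ x ∉ U i, g' i x = -1 := fun i x hx => by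
    rw [hg' i x (by simp [hg2 i hx]), hg2 i hx]; rfl
  -- Each point belongs to the set of its first index with `0 ≤ g' i x`. If a point lies in `n + 2`
  -- of the sets, membership in the last one forces `g' i x ≤ 0` at the other `n + 1` indices, so
  -- all those functions vanish there, which the perturbation excludes.
  refine ⟨fun i => {x | 0 ≤ g' i x} ∩ ⋂ j, ⋂ _ : j < i, {x | g' j x ≤ 0}, fun i => ?_,
    fun i x hx => ?_, ?_, fun σ hσ => ?_⟩
  · exact (isClosed_le continuous_const (g' i).continuous).inter
      (isClosed_iInter fun j => isClosed_iInter fun _ =>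
        isClosed_le (g' j).continuous continuous_const)
  · by_contra hxU
    have := hx.1
    simp only [mem_ofPred_eq, hU' i x hxU] at this
    linarith
  · refine eq_univ_of_forall fun x => ?_
    obtain ⟨i, hi⟩ : ∃ i, x ∈ C i := mem_iUnion.1 (hCcov ▸ mem_univ x)
    have hne : (Finset.univ.filter fun i => 0 ≤ g' i x).Nonempty :=
      ⟨i, by simp [hC' i x hi]⟩
    refine mem_iUnion.2 ⟨_, (Finset.mem_filter.1 (Finset.min'_mem _ hne)).2, ?_⟩
    simp only [mem_iInter, mem_ofPred_eq]
    intro j hj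
    by_contra! hcon
    exact absurd (Finset.min'_le _ j (by simp [hcon.le])) (not_le.2 hj)
  · refine eq_empty_of_forall_notMem fun x hx => ?_
    simp only [mem_iInter, mem_inter_iff, mem_ofPred_eq] at hx
    have hne : σ.Nonempty := Finset.card_pos.1 (by omega)
    obtain ⟨i, hi, hci⟩ := hT (σ.erase (σ.max' hne))
      (by simp [Finset.card_erase_of_mem (σ.max'_mem hne), hσ]) x
    have hlt : i < σ.max' hne :=
      lt_of_le_of_ne (σ.le_max' i (Finset.mem_of_mem_erase hi)) (Finset.ne_of_mem_erase hi)
    have h0 : g' i x = 0 := le_antisymm ((hx _ (σ.max'_mem hne)).2 i hlt)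
      (hx i (Finset.mem_of_mem_erase hi)).1
    rw [h0, abs_zero] at hci
    linarith

/-! ### Gluing and descent of continuity -/

theorem ContinuousOn.piecewise_of_isClosed {X Y : Type*} [TopologicalSpace X] [TopologicalSpace Y]
    {D E N : Set X} [∀ x, Decidable (x ∈ D)] (hD : IsClosed D) (hE : IsClosed E)
    (hN : N ⊆ D ∪ E) {f g : X → Y} (hf : ContinuousOn f (D ∩ N)) (hg : ContinuousOn g (E ∩ N))
    (hfg : ∀ x ∈ D, x ∈ E → x ∈ N → f x = g x) : ContinuousOn (D.piecewise f g) N := by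
  have hD' : ContinuousOn (D.piecewise f g) (D ∩ N) :=
    hf.congr fun x hx => D.piecewise_eq_of_mem _ _ hx.1
  have hE' : ContinuousOn (D.piecewise f g) (E ∩ N) := hg.congr fun x hx => by
    by_cases hxD : x ∈ D
    · rw [D.piecewise_eq_of_mem _ _ hxD, hfg x hxD hx.1 hx.2]
    · rw [D.piecewise_eq_of_notMem _ _ hxD]
  have key : ∀ C : Set X, IsClosed C → ContinuousOn (D.piecewise f g) (C ∩ N) → ∀ x ∈ N,
      ContinuousWithinAt (D.piecewise f g) (C ∩ N) x := by
    intro C hC h x hx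
    by_cases hxC : x ∈ C
    · exact h x ⟨hxC, hx⟩
    · have : 𝓝[C ∩ N] x = ⊥ := by
        rw [← notMem_closure_iff_nhdsWithin_eq_bot]
        exact fun hcl => hxC (closure_minimal inter_subset_left hC hcl)
      simp only [ContinuousWithinAt, this, Filter.tendsto_bot]
  intro x hx
  refine ((key D hD hD' x hx).union (key E hE hE' x hx)).mono fun z hz => ?_
  exact (hN hz).imp (fun h => ⟨h, hz⟩) fun h => ⟨h, hz⟩

/-- A continuous map from a compact space to a Hausdorff space is closed, hence a quotient map onto
its image. -/
theorem IsCompact.continuousOn_image_of_comp {X Y Z : Type*} [TopologicalSpace X]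
    [TopologicalSpace Y] [T2Space Y] [TopologicalSpace Z] {K : Set X} (hK : IsCompact K)
    {f : X → Y} (hf : ContinuousOn f K) {g : Y → Z} (hg : ContinuousOn (g ∘ f) K) :
    ContinuousOn g (f '' K) := by
  rw [continuousOn_iff_isClosed]
  intro t ht
  obtain ⟨u, hu, hut⟩ := continuousOn_iff_isClosed.1 hg t ht
  refine ⟨f '' (u ∩ K), ((hK.inter_left hu).image_of_continuousOn
    (hf.mono inter_subset_right)).isClosed, ?_⟩
  ext y
  constructor
  · rintro ⟨hy, x, hx, rfl⟩
    exact ⟨⟨x, hut ▸ ⟨hy, hx⟩, rfl⟩, x, hx, rfl⟩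
  · rintro ⟨⟨x, hx, rfl⟩, hy⟩
    exact ⟨(hut.symm ▸ hx : x ∈ (g ∘ f) ⁻¹' t ∩ K).1, hy⟩

/-! ### Neighbourhood retraction after attaching a cell -/

section Attach

variable {Q E : Type*} [MetricSpace Q] [NormedAddCommGroup E] [NormedSpace ℝ E] [ProperSpace E]

open Metric Filter

/-- Attaching a cell to a compact neighbourhood extensor `F` in a metric space `Q` yields a
neighbourhood retract of `Q`. Here `P` is the characteristic map of the cell, `b` is a continuous
function vanishing on `F` and positive on the open cell, and `y` extends the inverse of `P`. -/
theorem exists_retraction_of_attach {F : Set Q} (hF : IsCompact F)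
    (hext : ∀ A : Set Q, IsClosed A → ∀ f : Q → Q, ContinuousOn f A → MapsTo f A F →
      ∃ (O : Set Q) (g : Q → Q), IsOpen O ∧ A ⊆ O ∧ ContinuousOn g O ∧ MapsTo g O F ∧ EqOn g f A)
    {P : E → Q} (hP : ContinuousOn P (closedBall 0 1)) {b : Q → ℝ} (hb : Continuous b)
    {y : Q → E} (hy : ContinuousOn y {x | 0 < b x}) (hy1 : ∀ x, ‖y x‖ ≤ 1)
    (hbF : ∀ x ∈ F, b x = 0) (hPb : ∀ z, ‖z‖ < 1 → 0 < b (P z))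
    (hPy : ∀ z, ‖z‖ < 1 → y (P z) = z) (hPF : ∀ z, ‖z‖ = 1 → P z ∈ F) :
    ∃ (O : Set Q) (r : Q → Q), IsOpen O ∧ F ∪ P '' closedBall 0 1 ⊆ O ∧ ContinuousOn r O ∧
      MapsTo r O (F ∪ P '' closedBall 0 1) ∧ EqOn r id (F ∪ P '' closedBall 0 1) := by
  classical
  have hpos : IsOpen {x | 0 < b x} := isOpen_lt continuous_const hb
  have hy1' : ∀ x, y x ∈ closedBall (0 : E) 1 := fun x => mem_closedBall_zero_iff.2 (hy1 x)
  set dev : Q → ℝ := fun x => dist (P (y x)) x with hdev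
  have hPyc : ContinuousOn (fun x => P (y x)) {x | 0 < b x} := hP.comp hy fun x _ => hy1' x
  have hdevc : ContinuousOn dev {x | 0 < b x} := continuous_dist.comp_continuousOn (hPyc.prodMk continuousOn_id)
  have hdev0 : ∀ x, 0 ≤ dev x := fun x => dist_nonneg
  -- limits of points of the cell part
  have key : ∀ (g : Ultrafilter Q) (x : Q), ↑g ≤ 𝓝 x → {x | 0 < b x ∧ dev x ≤ b x / 2} ∈ g →
      b x ≤ 0 → x ∈ F ∧ ∃ y₀ : E, ‖y₀‖ = 1 ∧ P y₀ = x ∧ Tendsto y g (𝓝 y₀) := by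
    intro g x hgx hg hbx
    obtain ⟨y₀, hy₀, hle⟩ := (isCompact_closedBall (0 : E) 1).ultrafilter_le_nhds (g.map y)
      (tendsto_principal.2 (Eventually.of_forall hy1') : Tendsto y g _)
    have hty : Tendsto y g (𝓝 y₀) := hle
    have htb : Tendsto b g (𝓝 (b x)) := hb.continuousAt.tendsto.mono_left hgx
    have hbx0 : b x = 0 := le_antisymm hbx
      (ge_of_tendsto htb (by filter_upwards [hg] with z hz using hz.1.le))
    have htP : Tendsto (fun z => P (y z)) g (𝓝 (P y₀)) :=
      (hP y₀ hy₀).tendsto.comp (tendsto_nhdsWithin_iff.2 ⟨hty, Eventually.of_forall hy1'⟩)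
    have htd : Tendsto dev g (𝓝 0) := by
      refine tendsto_of_tendsto_of_tendsto_of_le_of_le' tendsto_const_nhds
        (h := fun z => b z / 2) ?_ (Eventually.of_forall hdev0)
        (by filter_upwards [hg] with z hz using hz.2)
      simpa [hbx0] using htb.div_const 2
    have hPx : P y₀ = x := by
      have h1 : Tendsto dev g (𝓝 (dist (P y₀) x)) := htP.dist hgx
      exact dist_eq_zero.1 (tendsto_nhds_unique h1 htd)
    have hn : ‖y₀‖ = 1 := by
      by_contra hne
      have := hPb y₀ (lt_of_le_of_ne (mem_closedBall_zero_iff.1 hy₀) hne)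
      rw [hPx] at this
      linarith
    exact ⟨hPx ▸ hPF _ hn, y₀, hn, hPx, hty⟩
  -- Close to the cell (`dev ≤ b / 2`) points go into the cell through `y` and a radial push;
  -- farther away the extensor property of `F` takes over. On the interface `dev = b / 2` the push
  -- ends in `F` as soon as `‖y x‖ ≥ 1 / 2`. The rest of the interface, `Bad`, is closed and misses
  -- `F` and the cell, so it can be discarded.
  set D : Set Q := F ∪ {x | 0 < b x ∧ dev x ≤ b x / 2} with hDdef
  set C : Set Q := {x | 0 < b x ∧ dev x < b x / 2}ᶜ with hCdef
  set A : Set Q := F ∪ {x | 0 < b x ∧ dev x = b x / 2 ∧ 1 / 2 ≤ ‖y x‖} with hAdef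
  set Bad : Set Q := {x | 0 < b x ∧ dev x = b x / 2 ∧ ‖y x‖ ≤ 1 / 2} with hBdef
  have hlim : ∀ (g : Ultrafilter Q) (x : Q), ↑g ≤ 𝓝 x → 0 < b x →
      Tendsto b g (𝓝 (b x)) ∧ Tendsto dev g (𝓝 (dev x)) ∧
        Tendsto (fun z => ‖y z‖) g (𝓝 ‖y x‖) := fun g x hgx hx =>
    ⟨hb.continuousAt.tendsto.mono_left hgx,
      (hdevc.continuousAt (hpos.mem_nhds hx)).tendsto.mono_left hgx,
      (hy.continuousAt (hpos.mem_nhds hx)).norm.tendsto.mono_left hgx⟩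
  have hD : IsClosed D := by
    rw [isClosed_iff_ultrafilter]
    intro x g hgx hg
    rcases (Ultrafilter.union_mem_iff).1 hg with h | h
    · exact Or.inl (isClosed_iff_ultrafilter.1 hF.isClosed x g hgx h)
    · rcases le_or_gt (b x) 0 with hx | hx
      · exact Or.inl (key g x hgx h hx).1
      · obtain ⟨h1, h2, -⟩ := hlim g x hgx hx
        exact Or.inr ⟨hx, le_of_tendsto_of_tendsto h2 (h1.div_const 2)
          (by filter_upwards [h] with z hz using hz.2)⟩
  have hC : IsClosed C := by
    rw [hCdef, isClosed_compl_iff]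
    have : {x | 0 < b x ∧ dev x < b x / 2} = {x | 0 < b x} ∩ (fun x => b x / 2 - dev x) ⁻¹' Ioi 0 := by
      ext x; simp [sub_pos]
    rw [this]
    exact ((hb.div_const 2).continuousOn.sub hdevc).isOpen_inter_preimage hpos isOpen_Ioi
  have hA : IsClosed A := by
    rw [isClosed_iff_ultrafilter]
    intro x g hgx hg
    rcases (Ultrafilter.union_mem_iff).1 hg with h | h
    · exact Or.inl (isClosed_iff_ultrafilter.1 hF.isClosed x g hgx h)
    · rcases le_or_gt (b x) 0 with hx | hx
      · exact Or.inl (key g x hgx (mem_of_superset h fun z hz => ⟨hz.1, hz.2.1.le⟩) hx).1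
      · obtain ⟨h1, h2, h3⟩ := hlim g x hgx hx
        exact Or.inr ⟨hx, tendsto_nhds_unique_of_eventuallyEq h2 (h1.div_const 2)
          (by filter_upwards [h] with z hz using hz.2.1),
          ge_of_tendsto h3 (by filter_upwards [h] with z hz using hz.2.2)⟩
  have hBad : IsClosed Bad := by
    rw [isClosed_iff_ultrafilter]
    intro x g hgx h
    rcases le_or_gt (b x) 0 with hx | hx
    · obtain ⟨-, y₀, hn, -, ht⟩ := key g x hgx (mem_of_superset h fun z hz => ⟨hz.1, hz.2.1.le⟩) hx
      have := le_of_tendsto ht.norm (by filter_upwards [h] with z hz using hz.2.2)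
      rw [hn] at this
      norm_num at this
    · obtain ⟨h1, h2, h3⟩ := hlim g x hgx hx
      exact ⟨hx, tendsto_nhds_unique_of_eventuallyEq h2 (h1.div_const 2)
        (by filter_upwards [h] with z hz using hz.2.1),
        le_of_tendsto h3 (by filter_upwards [h] with z hz using hz.2.2)⟩
  -- the radial push towards the boundary of the cell
  set m : Q → ℝ := fun x => max ‖y x‖ (1 - dev x / b x) with hm
  set s : Q → Q := fun x => if x ∈ F then x else P ((m x)⁻¹ • y x) with hs
  have hball : ∀ x, (m x)⁻¹ • y x ∈ closedBall (0 : E) 1 := by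
    intro x
    rw [mem_closedBall_zero_iff, norm_smul, norm_inv, Real.norm_eq_abs,
      abs_of_nonneg ((norm_nonneg _).trans (le_max_left _ _)), ← div_eq_inv_mul]
    exact div_le_one_of_le₀ (le_max_left _ _) ((norm_nonneg _).trans (le_max_left _ _))
  have hsF : ∀ x ∈ F, s x = x := fun x hx => if_pos hx
  have hsP : ∀ x, 0 < b x → s x = P ((m x)⁻¹ • y x) := fun x hx =>
    if_neg fun h => by rw [hbF x h] at hx; exact lt_irrefl _ hx
  have hsmaps : ∀ x, s x ∈ F ∪ P '' closedBall 0 1 := by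
    intro x
    by_cases hx : x ∈ F
    · rw [hsF x hx]; exact Or.inl hx
    · rw [hs]; simp only [if_neg hx]; exact Or.inr (mem_image_of_mem _ (hball x))
  have hscont : ContinuousOn s D := by
    intro x hx
    rcases le_or_gt (b x) 0 with hbx | hbx
    · have hxF : x ∈ F := hx.resolve_right fun h => absurd h.1 (not_lt.2 hbx)
      rw [ContinuousWithinAt, hsF x hxF, tendsto_iff_ultrafilter]
      intro g hg
      have hgx : ↑g ≤ 𝓝 x := hg.trans nhdsWithin_le_nhds
      have hgD : D ∈ g := le_principal_iff.1 (hg.trans inf_le_right)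
      rcases (Ultrafilter.union_mem_iff).1 hgD with h | h
      · exact Tendsto.congr' (by filter_upwards [h] with z hz using (hsF z hz).symm) hgx
      · obtain ⟨-, y₀, hn, hPx, ht⟩ := key g x hgx h hbx
        have htm : Tendsto m g (𝓝 1) := by
          refine tendsto_of_tendsto_of_tendsto_of_le_of_le' (hn ▸ ht.norm) tendsto_const_nhds
            (Eventually.of_forall fun z => le_max_left _ _) ?_
          filter_upwards [h] with z hz
          exact max_le (hy1 z) (by have := div_nonneg (hdev0 z) hz.1.le; linarith)
        have h2 : Tendsto (fun z => (m z)⁻¹ • y z) g (𝓝 y₀) := by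
          simpa using (htm.inv₀ one_ne_zero).smul ht
        have h3 : Tendsto (fun z => P ((m z)⁻¹ • y z)) g (𝓝 (P y₀)) :=
          (hP y₀ (mem_closedBall_zero_iff.2 hn.le)).tendsto.comp
            (tendsto_nhdsWithin_iff.2 ⟨h2, Eventually.of_forall hball⟩)
        rw [hPx] at h3
        exact h3.congr' (by filter_upwards [h] with z hz using (hsP z hz.1).symm)
    · have hxD : dev x ≤ b x / 2 := by
        rcases hx with h | h
        · rw [hbF x h] at hbx; exact absurd hbx (lt_irrefl _)
        · exact h.2
      have hmx : 0 < m x := by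
        refine lt_of_lt_of_le ?_ (le_max_right _ _)
        have : dev x / b x ≤ 1 / 2 := by rw [div_le_iff₀ hbx]; linarith
        linarith
      have hya := hy.continuousAt (hpos.mem_nhds hbx)
      have hma : ContinuousAt m x := hya.norm.max (continuousAt_const.sub
        ((hdevc.continuousAt (hpos.mem_nhds hbx)).div hb.continuousAt hbx.ne'))
      have h1 : ContinuousAt (fun z => (m z)⁻¹ • y z) x := (hma.inv₀ hmx.ne').smul hya
      have h2 : Tendsto (fun z => P ((m z)⁻¹ • y z)) (𝓝 x) (𝓝 (P ((m x)⁻¹ • y x))) :=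
        (hP _ (hball x)).tendsto.comp
            (tendsto_nhdsWithin_iff.2 ⟨h1, Eventually.of_forall hball⟩)
      rw [← hsP x hbx] at h2
      refine ContinuousAt.continuousWithinAt (h2.congr' ?_)
      filter_upwards [hpos.mem_nhds hbx] with z hz using (hsP z hz).symm
  have hsA : MapsTo s A F := by
    rintro x (hx | ⟨hbx, hd, hn⟩)
    · rw [hsF x hx]; exact hx
    · rw [hsP x hbx]
      have h1 : dev x / b x = 1 / 2 := by rw [hd]; field_simp
      have h2 : m x = ‖y x‖ := max_eq_left (by rw [h1]; linarith)
      refine hPF _ ?_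
      rw [h2, norm_smul, norm_inv, norm_norm, inv_mul_cancel₀ (by linarith)]
  have hAD : A ⊆ D := union_subset_union_right _ fun x hx => ⟨hx.1, hx.2.1.le⟩
  obtain ⟨O, g, hO, hAO, hgc, hgF, hgs⟩ := hext A hA s (hscont.mono hAD) hsA
  -- Removing `C \ O` leaves `g` defined wherever it is needed; removing `Bad` leaves an overlap of
  -- `D` and `C` contained in `A`, where `s` and `g` agree.
  refine ⟨(C \ O)ᶜ ∩ Badᶜ, D.piecewise s g,
    (hC.sdiff hO).isOpen_compl.inter hBad.isOpen_compl, ?_, ?_, ?_, ?_⟩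
  · rintro x (hx | ⟨z, hz, rfl⟩)
    · exact ⟨fun h => h.2 (hAO (Or.inl hx)), fun h => by
        have := h.1; rw [hbF x hx] at this; exact lt_irrefl _ this⟩
    · rcases (mem_closedBall_zero_iff.1 hz).lt_or_eq with hz | hz
      · have hd : dev (P z) = 0 := by simp [hdev, hPy z hz]
        have hbz := hPb z hz
        exact ⟨fun h => h.1 ⟨hbz, by rw [hd]; linarith⟩, fun h => by
          have := h.2.1; rw [hd] at this; linarith⟩
      · have hx := hPF z hz
        exact ⟨fun h => h.2 (hAO (Or.inl hx)), fun h => by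
          have := h.1; rw [hbF _ hx] at this; exact lt_irrefl _ this⟩
  · refine ContinuousOn.piecewise_of_isClosed hD hC (fun x _ => ?_)
      (hscont.mono inter_subset_left) (hgc.mono ?_) ?_
    · by_cases hx : x ∈ C
      · exact Or.inr hx
      · have hx' : 0 < b x ∧ dev x < b x / 2 := not_not.1 hx
        exact Or.inl (Or.inr ⟨hx'.1, hx'.2.le⟩)
    · rintro x ⟨hxC, hx, -⟩
      by_contra hxO
      exact hx ⟨hxC, hxO⟩
    · rintro x (hx | hx) hxC ⟨-, hxB⟩
      · exact (hgs (Or.inl hx)).symm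
      · have hd : dev x = b x / 2 := le_antisymm hx.2 (not_lt.1 fun h => hxC ⟨hx.1, h⟩)
        refine (hgs (Or.inr ⟨hx.1, hd, ?_⟩)).symm
        by_contra! hcon
        exact hxB ⟨hx.1, hd, hcon.le⟩
  · rintro x ⟨hx, -⟩
    by_cases hxD : x ∈ D
    · rw [D.piecewise_eq_of_mem _ _ hxD]; exact hsmaps x
    · rw [D.piecewise_eq_of_notMem _ _ hxD]
      refine Or.inl (hgF ?_)
      by_contra hxO
      refine hx ⟨fun h => hxD (Or.inr ⟨h.1, h.2.le⟩), hxO⟩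
  · rintro x (hx | ⟨z, hz, rfl⟩)
    · rw [D.piecewise_eq_of_mem _ _ (Or.inl hx), hsF x hx]; rfl
    · rcases (mem_closedBall_zero_iff.1 hz).lt_or_eq with hz | hz
      · have hd : dev (P z) = 0 := by simp [hdev, hPy z hz]
        have hbz := hPb z hz
        rw [D.piecewise_eq_of_mem _ _ (Or.inr ⟨hbz, by rw [hd]; linarith⟩), hsP _ hbz]
        have : m (P z) = 1 := by
          simp only [hm, hPy z hz, hd, zero_div, sub_zero]
          exact max_eq_right hz.le
        rw [this, hPy z hz, inv_one, one_smul]; rfl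
      · rw [D.piecewise_eq_of_mem _ _ (Or.inl (hPF z hz)), hsF _ (hPF z hz)]; rfl

end Attach

/-! ### Compact neighbourhood retracts of normed spaces -/

/-- `S` is compact and homeomorphic to a neighbourhood retract of a finite-dimensional normed
space. -/
def IsCompactENR {L : Type u} [TopologicalSpace L] (S : Set L) : Prop :=
  IsCompact S ∧ ∃ (Q : Type) (_ : NormedAddCommGroup Q) (_ : NormedSpace ℝ Q)
    (_ : FiniteDimensional ℝ Q) (i : L → Q) (r : Q → L) (O : Set Q),
    ContinuousOn i S ∧ IsOpen O ∧ MapsTo i S O ∧ ContinuousOn r O ∧ MapsTo r O S ∧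
      ∀ s ∈ S, r (i s) = s

theorem isCompactENR_empty {L : Type u} [TopologicalSpace L] [Nonempty L] :
    IsCompactENR (∅ : Set L) :=
  ⟨isCompact_empty, ℝ, inferInstance, inferInstance, inferInstance, 0,
    fun _ => Classical.arbitrary L, ∅, by simp⟩

open Metric in
-- The enlarged set is embedded in `Q' × ℝⁿ × ℝ`, with `S` at last coordinate zero. On the cell the
-- first coordinate is a Tietze extension of `i' ∘ Φ` from the sphere, and `((1 - ‖z‖) • z, 1 -
-- ‖z‖)` vanishes on the sphere while determining `z` inside. Tietze extension and `r'` make the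
-- image of `S` a neighbourhood extensor, so `exists_retraction_of_attach` applies.
theorem IsCompactENR.attach {L : Type u} [TopologicalSpace L] [T2Space L] {S : Set L}
    (hS : IsCompactENR S) {n : ℕ} {Φ : (Fin n → ℝ) → L} (hΦ : ContinuousOn Φ (closedBall 0 1))
    (hinj : InjOn Φ (ball 0 1)) (hdisj : Disjoint (Φ '' ball 0 1) S) (hfr : MapsTo Φ (sphere 0 1) S) :
    IsCompactENR (S ∪ Φ '' closedBall 0 1) := by
  classical
  obtain ⟨hSc, Q', _, _, _, i', r', O', hi', hO', hiO', hr', hrS', hri'⟩ := hS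
  have hdisj' : ∀ z : Fin n → ℝ, ‖z‖ < 1 → Φ z ∉ S := fun z hz hzS =>
    disjoint_left.1 hdisj (mem_image_of_mem _ (mem_ball_zero_iff.2 hz)) hzS
  have hcompact : IsCompact (S ∪ Φ '' closedBall 0 1) :=
    hSc.union ((isCompact_closedBall _ _).image_of_continuousOn hΦ)
  obtain ⟨G, hG⟩ := (isClosed_sphere (x := (0 : Fin n → ℝ)) (ε := 1)).exists_continuousMap_eqOn
    (f := fun z => i' (Φ z)) (hi'.comp (hΦ.mono sphere_subset_closedBall) hfr)
  let P : (Fin n → ℝ) → Q' × (Fin n → ℝ) × ℝ := fun z => (G z, (1 - ‖z‖) • z, 1 - ‖z‖)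
  have hPc : Continuous P := by fun_prop
  let i : L → Q' × (Fin n → ℝ) × ℝ := fun x =>
    if x ∈ S then (i' x, 0, 0) else P (Function.invFunOn Φ (ball 0 1) x)
  have hiS : ∀ x ∈ S, i x = (i' x, 0, 0) := fun x hx => if_pos hx
  have hiΦ : ∀ z : Fin n → ℝ, ‖z‖ ≤ 1 → i (Φ z) = P z := by
    intro z hz
    rcases hz.lt_or_eq with hz | hz
    · have h1 : Function.invFunOn Φ (ball 0 1) (Φ z) = z :=
        hinj.leftInvOn_invFunOn (mem_ball_zero_iff.2 hz)
      simp only [i, if_neg (hdisj' z hz), h1]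
    · have hz' := mem_sphere_zero_iff_norm.2 hz
      rw [hiS _ (hfr hz')]
      simp [P, hz, hG hz']
  have hic : ContinuousOn i (S ∪ Φ '' closedBall 0 1) := by
    have h1 : ContinuousOn i S :=
      ContinuousOn.congr (hi'.prodMk (continuousOn_const (c := ((0 : Fin n → ℝ), (0 : ℝ))))) hiS
    have h2 : ContinuousOn i (Φ '' closedBall 0 1) :=
      (isCompact_closedBall _ _).continuousOn_image_of_comp hΦ
        (hPc.continuousOn.congr fun z hz => hiΦ z (mem_closedBall_zero_iff.1 hz))
    exact h1.union_of_isClosed h2 hSc.isClosed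
      ((isCompact_closedBall _ _).image_of_continuousOn hΦ).isClosed
  -- Division by the last coordinate recovers `z` on the open cell; the outer factor forces norm at
  -- most one elsewhere.
  let y : Q' × (Fin n → ℝ) × ℝ → (Fin n → ℝ) := fun q =>
    (max 1 ‖q.2.2⁻¹ • q.2.1‖)⁻¹ • q.2.2⁻¹ • q.2.1
  have hPy : ∀ z : Fin n → ℝ, ‖z‖ < 1 → y (P z) = z := by
    intro z hz
    have h0 : (1 - ‖z‖)⁻¹ • (1 - ‖z‖) • z = z := inv_smul_smul₀ (by linarith) z
    simp only [y, P, h0, max_eq_left hz.le, inv_one, one_smul]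
  have hPy1 : ∀ z, ‖z‖ < 1 → 0 < (P z).2.2 := fun z hz => by simpa [P] using hz
  have hiF : ∀ x ∈ S, (i x).2.2 = 0 := fun x hx => by rw [hiS x hx]
  have himage : i '' S ∪ P '' closedBall 0 1 = i '' (S ∪ Φ '' closedBall 0 1) := by
    rw [image_union, image_image]
    congr 1
    exact image_congr fun z hz => (hiΦ z (mem_closedBall_zero_iff.1 hz)).symm
  obtain ⟨O, R, hO, hFO, hRc, hRF, hRid⟩ := exists_retraction_of_attach
    (F := i '' S) (P := P) (b := fun q => q.2.2) (y := y)
    (hSc.image_of_continuousOn (hic.mono subset_union_left)) (by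
      intro A hA f hf hfA
      obtain ⟨g, hg⟩ := hA.exists_continuousMap_eqOn (continuous_fst.comp_continuousOn hf)
      refine ⟨g ⁻¹' O', fun q => i (r' (g q)), hO'.preimage g.continuous, fun a ha => ?_, ?_, ?_, ?_⟩
      · obtain ⟨s, hs, hsa⟩ := hfA ha
        rw [mem_preimage, hg ha, Function.comp_apply, ← hsa, hiS s hs]
        exact hiO' hs
      · exact (hic.mono subset_union_left).comp (hr'.comp g.continuous.continuousOn
          (mapsTo_preimage _ _)) fun q hq => hrS' hq
      · exact fun q hq => mem_image_of_mem _ (hrS' hq)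
      · intro a ha
        obtain ⟨s, hs, hsa⟩ := hfA ha
        simp only [hg ha, Function.comp_apply]
        rw [← hsa, hiS s hs, hri' s hs, hiS s hs])
    hPc.continuousOn (by fun_prop) (by
      have h1 : ContinuousOn (fun q : Q' × (Fin n → ℝ) × ℝ => q.2.2⁻¹ • q.2.1) {q | 0 < q.2.2} :=
        (ContinuousOn.inv₀ (f := fun q : Q' × (Fin n → ℝ) × ℝ => q.2.2) (by fun_prop)
          fun q hq => (ne_of_gt hq)).smul (by fun_prop)
      exact (ContinuousOn.inv₀ (continuousOn_const.sup h1.norm)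
        fun q _ => (lt_max_of_lt_left one_pos).ne').smul h1)
    (fun q => by
      rw [norm_smul, norm_inv, Real.norm_eq_abs, abs_of_pos (lt_max_of_lt_left one_pos),
        ← div_eq_inv_mul]
      exact div_le_one_of_le₀ (le_max_right _ _) (by positivity))
    (by rintro _ ⟨x, hx, rfl⟩; exact hiF x hx) hPy1 hPy
    (fun z hz => ⟨Φ z, hfr (mem_sphere_zero_iff_norm.2 hz), hiΦ z hz.le⟩)
  rw [himage] at hFO hRF hRid
  let κ : Q' × (Fin n → ℝ) × ℝ → L := fun q => if 0 < q.2.2 then Φ (y q) else r' q.1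
  have hκ : ∀ x ∈ S ∪ Φ '' closedBall 0 1, κ (i x) = x := by
    have hκS : ∀ x ∈ S, κ (i x) = x := fun x hx => by
      simp only [κ, hiF x hx, lt_irrefl, if_false]
      rw [hiS x hx, hri' x hx]
    rintro x (hx | ⟨z, hz, rfl⟩)
    · exact hκS x hx
    · rcases (mem_closedBall_zero_iff.1 hz).lt_or_eq with hz | hz
      · rw [hiΦ z hz.le]
        simp only [κ, if_pos (hPy1 z hz), hPy z hz]
      · exact hκS _ (hfr (mem_sphere_zero_iff_norm.2 hz))
  have hκc : ContinuousOn κ (i '' (S ∪ Φ '' closedBall 0 1)) :=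
    hcompact.continuousOn_image_of_comp hic (continuousOn_id.congr hκ)
  refine ⟨hcompact, Q' × (Fin n → ℝ) × ℝ, inferInstance, inferInstance, inferInstance, i,
    fun q => κ (R q), O, hic, hO, fun x hx => hFO (mem_image_of_mem _ hx), hκc.comp hRc hRF, ?_, ?_⟩
  · intro q hq
    obtain ⟨x, hx, hxq⟩ := hRF hq
    simp only
    rw [← hxq, hκ x hx]
    exact hx
  · intro x hx
    have := hRid (mem_image_of_mem i hx)
    simp only [id_eq] at this
    simp only [this, hκ x hx]

/-! ### Finite unions of cells -/

namespace CWComplex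

variable {L : Type u} [TopologicalSpace L] [Topology.CWComplex (univ : Set L)]

open RelCWComplex

/-- The union of a finite set of open cells. -/
def cellUnion (J : Finset (Σ n, cell (univ : Set L) n)) : Set L := ⋃ γ ∈ J, openCell γ.1 γ.2

theorem cellUnion_mono {J J' : Finset (Σ n, cell (univ : Set L) n)} (h : J ⊆ J') :
    cellUnion J ⊆ cellUnion J' :=
  biUnion_subset_biUnion_left h

/-- Strong induction on the dimension: the frontier meets finitely many open cells, all of lower
dimension. These are added first, and then the cell itself is attached. -/
theorem exists_isCompactENR_insert [T2Space L] (n : ℕ) (i : cell (univ : Set L) n)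
    (J : Finset (Σ n, cell (univ : Set L) n)) (hJ : IsCompactENR (cellUnion J)) :
    ∃ J', J ⊆ J' ∧ ⟨n, i⟩ ∈ J' ∧ IsCompactENR (cellUnion J') := by
  classical
  induction n using Nat.strong_induction_on generalizing J with
  | _ n ih =>
  have hfin : ∀ T : Finset (Σ n, cell (univ : Set L) n), (∀ γ ∈ T, γ.1 < n) →
      ∃ J', J ⊆ J' ∧ T ⊆ J' ∧ IsCompactENR (cellUnion J') := by
    intro T
    induction T using Finset.induction_on with
    | empty => exact fun _ => ⟨J, Finset.Subset.rfl, Finset.empty_subset _, hJ⟩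
    | insert γ T _ ihT =>
      intro hT
      obtain ⟨J₁, h1, h2, h3⟩ := ihT fun γ' h => hT γ' (Finset.mem_insert_of_mem h)
      obtain ⟨J₂, h4, h5, h6⟩ := ih γ.1 (hT γ (Finset.mem_insert_self _ _)) γ.2 J₁ h3
      exact ⟨J₂, h1.trans h4, Finset.insert_subset h5 (h2.trans h4), h6⟩
  obtain ⟨I, hI⟩ := Topology.CWComplex.cellFrontier_subset_finite_openCell n i
  obtain ⟨J₁, hJJ, hT, hJ₁⟩ := hfin ((Finset.range n).sigma I) (by simp +contextual)
  by_cases hmem : (⟨n, i⟩ : Σ n, cell (univ : Set L) n) ∈ J₁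
  · exact ⟨J₁, hJJ, hmem, hJ₁⟩
  have hfr : cellFrontier n i ⊆ cellUnion J₁ := by
    refine hI.trans fun x hx => ?_
    simp only [mem_iUnion] at hx
    obtain ⟨k, hk, j, hj, hx⟩ := hx
    exact mem_biUnion (hT (Finset.mem_sigma.2 ⟨Finset.mem_range.2 hk, hj⟩) : (⟨k, j⟩ : Σ n, _) ∈ _) hx
  refine ⟨insert ⟨n, i⟩ J₁, hJJ.trans (Finset.subset_insert _ _), Finset.mem_insert_self _ _, ?_⟩
  have heq : cellUnion (insert ⟨n, i⟩ J₁) =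
      cellUnion J₁ ∪ map (C := (univ : Set L)) n i '' Metric.closedBall 0 1 := by
    have h1 : cellUnion (insert ⟨n, i⟩ J₁) = openCell n i ∪ cellUnion J₁ :=
      Finset.set_biUnion_insert _ _ _
    have h2 : map (C := (univ : Set L)) n i '' Metric.closedBall 0 1 =
        cellFrontier n i ∪ openCell n i := (cellFrontier_union_openCell_eq_closedCell n i).symm
    rw [h1, h2, ← union_assoc, union_eq_self_of_subset_right hfr, union_comm]
  rw [heq]
  refine hJ₁.attach (RelCWComplex.continuousOn n i) ?_ ?_ ?_
  · rw [← RelCWComplex.source_eq n i]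
    exact (map n i).injOn
  · refine disjoint_iUnion₂_right.2 fun γ hγ => ?_
    exact disjoint_openCell_of_ne (C := (univ : Set L)) fun h => hmem (h ▸ hγ)
  · exact fun z hz => hfr (mem_image_of_mem _ hz)

theorem exists_isCompactENR [T2Space L] [Nonempty L] (T : Finset (Σ n, cell (univ : Set L) n)) :
    ∃ J, T ⊆ J ∧ IsCompactENR (cellUnion J) := by
  classical
  induction T using Finset.induction_on with
  | empty => exact ⟨∅, Finset.Subset.rfl, by simpa [cellUnion] using isCompactENR_empty⟩
  | insert γ T _ ih =>
    obtain ⟨J₁, h1, h2⟩ := ih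
    obtain ⟨J₂, h3, h4, h5⟩ := exists_isCompactENR_insert γ.1 γ.2 J₁ h2
    exact ⟨J₂, Finset.insert_subset h4 (h1.trans h3), h5⟩

theorem exists_mem_openCell (x : L) : ∃ γ : Σ n, cell (univ : Set L) n, x ∈ openCell γ.1 γ.2 := by
  have := mem_univ x
  rw [← Topology.CWComplex.iUnion_openCell_eq_complex (C := (univ : Set L))] at this
  simp only [mem_iUnion] at this
  obtain ⟨n, j, h⟩ := this
  exact ⟨⟨n, j⟩, h⟩

theorem finite_openCell_inter_closedCell (n : ℕ) (j : cell (univ : Set L) n) :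
    ∃ J : Finset (Σ n, cell (univ : Set L) n), closedCell n j ⊆ cellUnion J := by
  classical
  obtain ⟨I, hI⟩ := Topology.CWComplex.cellFrontier_subset_finite_openCell n j
  refine ⟨insert ⟨n, j⟩ ((Finset.range n).sigma I), ?_⟩
  rw [← cellFrontier_union_openCell_eq_closedCell]
  refine union_subset (hI.trans fun x hx => ?_)
    fun x hx => mem_biUnion (Finset.mem_insert_self _ _ : (⟨n, j⟩ : Σ n, _) ∈ _) hx
  simp only [mem_iUnion] at hx
  obtain ⟨k, hk, j, hj, hx⟩ := hx
  exact mem_biUnion (Finset.mem_insert_of_mem (Finset.mem_sigma.2 ⟨Finset.mem_range.2 hk, hj⟩) :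
    (⟨k, j⟩ : Σ n, _) ∈ _) hx

/-- A sequence of subsets converging to a point eventually lies in a finite union of cells. -/
theorem exists_forall_subset_cellUnion [T2Space L] {p : L} {T : ℕ → Set L}
    (hT : ∀ V ∈ 𝓝 p, ∀ᶠ k in Filter.atTop, T k ⊆ V) :
    ∃ (J : Finset (Σ n, cell (univ : Set L) n)) (N : ℕ), ∀ k ≥ N, T k ⊆ cellUnion J := by
  classical
  by_contra! hcon
  choose c hc using exists_mem_openCell (L := L)
  have hcu : ∀ {γ : Σ n, cell (univ : Set L) n} {x : L}, x ∈ openCell γ.1 γ.2 → c x = γ := by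
    intro γ x hx
    by_contra hne
    exact disjoint_left.1 (disjoint_openCell_of_ne (C := (univ : Set L)) hne) (hc x) hx
  -- Otherwise there are points `x ∈ T k`, with `k` increasing, in pairwise distinct open cells.
  obtain ⟨f, hf, hr⟩ := exists_seq_of_forall_finset_exists (fun q : ℕ × L => q.2 ∈ T q.1)
    (fun q q' => q.1 < q'.1 ∧ c q.2 ≠ c q'.2) (by
      intro s _
      obtain ⟨k, hk, hkT⟩ := hcon (s.image fun q => c q.2) (s.sup Prod.fst + 1)
      obtain ⟨x, hx, hxn⟩ := not_subset.1 hkT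
      refine ⟨(k, x), hx, fun q hq => ⟨?_, fun h => hxn ?_⟩⟩
      · have := Finset.le_sup (f := Prod.fst) hq
        dsimp only at this ⊢
        omega
      · exact mem_biUnion (Finset.mem_coe.2 (Finset.mem_image_of_mem _ hq)) (h ▸ hc x))
  have hcinj : Function.Injective fun n => c (f n).2 := by
    intro m n hmn
    rcases lt_trichotomy m n with h | h | h
    · exact absurd hmn (hr m n h).2
    · exact h
    · exact absurd hmn.symm (hr n m h).2
  -- Each closed cell meets the sequence in a finite set, so the sequence without `p` is closed in
  -- the weak topology. Convergence to `p` then forces the sequence to equal `p` eventually, against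
  -- the distinctness of the cells.
  have hclosed : IsClosed (range (fun n => (f n).2) \ {p}) := by
    refine Topology.CWComplex.closed' (C := (univ : Set L)) _ (subset_univ _) fun n j => ?_
    obtain ⟨J, hJ⟩ := finite_openCell_inter_closedCell n j
    refine Set.Finite.isClosed ?_
    refine ((J.finite_toSet.preimage (hcinj.injOn)).image fun n => (f n).2).subset ?_
    rintro _ ⟨⟨⟨k, rfl⟩, -⟩, hk⟩
    have := hJ hk
    obtain ⟨γ, hγ, hx⟩ := mem_iUnion₂.1 this
    exact ⟨k, by simpa [hcu hx] using hγ, rfl⟩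
  have hmono : StrictMono fun n => (f n).1 := fun m n h => (hr m n h).1
  obtain ⟨N, hN⟩ := Filter.eventually_atTop.1 (hT _ (hclosed.isOpen_compl.mem_nhds (by simp)))
  have hp : ∀ n ≥ N, (f n).2 = p := by
    intro n hn
    have := hN (f n).1 (hn.trans (hmono.id_le n)) (hf n)
    simpa using this
  exact (hr N (N + 1) (Nat.lt_succ_self N)).2 (by rw [hp N le_rfl, hp (N + 1) (Nat.le_succ N)])

end CWComplex

/-! ### Sequences of spaces converging to a point -/

/-- The disjoint union of a sequence of spaces together with a point at infinity, whose
neighbourhoods contain all but finitely many of the spaces. -/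
def NullSequence (X : ℕ → Type u) : Type u := Option (Σ k, X k)

namespace NullSequence

variable {X : ℕ → Type u}

/-- The point at infinity. -/
def pt : NullSequence X := none

/-- The inclusion of the `k`-th space. -/
def inc (k : ℕ) (x : X k) : NullSequence X := some ⟨k, x⟩

/-- The map out of `NullSequence X` given by its values. -/
def desc {Y : Type*} (y : Y) (g : ∀ k, X k → Y) : NullSequence X → Y
  | none => y
  | some ⟨k, x⟩ => g k x

@[simp] theorem desc_pt {Y : Type*} (y : Y) (g : ∀ k, X k → Y) : desc y g pt = y := rfl

@[simp] theorem desc_inc {Y : Type*} (y : Y) (g : ∀ k, X k → Y) (k : ℕ) (x : X k) :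
    desc y g (inc k x) = g k x := rfl

theorem ind {p : NullSequence X → Prop} (h0 : p pt) (h : ∀ k x, p (inc k x)) : ∀ z, p z
  | none => h0
  | some ⟨k, x⟩ => h k x

theorem inc_eq_inc_iff {k k' : ℕ} {x : X k} {x' : X k'} :
    inc k x = inc k' x' ↔ (⟨k, x⟩ : Σ k, X k) = ⟨k', x'⟩ := Option.some_inj

theorem inc_injective (k : ℕ) : Function.Injective (inc (X := X) k) := fun x y h => by
  cases inc_eq_inc_iff.1 h
  rfl

theorem inc_ne_pt (k : ℕ) (x : X k) : inc k x ≠ pt := Option.some_ne_none _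

theorem preimage_inc_image_of_ne {k k' : ℕ} (h : k' ≠ k) (U : Set (X k)) :
    inc k' ⁻¹' (inc k '' U) = ∅ := by
  refine eq_empty_of_forall_notMem ?_
  rintro x ⟨y, -, hy⟩
  exact h (congrArg Sigma.fst (inc_eq_inc_iff.1 hy)).symm

/-- The point at infinity together with all spaces of index at least `N`. -/
def tail (N : ℕ) : Set (NullSequence X) := desc True fun k _ => N ≤ k

@[simp] theorem pt_mem_tail (N : ℕ) : (pt : NullSequence X) ∈ tail N := trivial

@[simp] theorem inc_mem_tail {N k : ℕ} {x : X k} : inc k x ∈ tail N ↔ N ≤ k := Iff.rfl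

variable [∀ k, TopologicalSpace (X k)]

instance : TopologicalSpace (NullSequence X) where
  IsOpen U := (∀ k, IsOpen (inc k ⁻¹' U)) ∧ (pt ∈ U → ∃ N, ∀ k ≥ N, ∀ x, inc k x ∈ U)
  isOpen_univ := by simp
  isOpen_inter U V hU hV := by
    refine ⟨fun k => (hU.1 k).inter (hV.1 k), fun h => ?_⟩
    obtain ⟨N, hN⟩ := hU.2 h.1
    obtain ⟨N', hN'⟩ := hV.2 h.2
    exact ⟨max N N', fun k hk x => ⟨hN k (le_of_max_le_left hk) x, hN' k (le_of_max_le_right hk) x⟩⟩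
  isOpen_sUnion S hS := by
    refine ⟨fun k => ?_, ?_⟩
    · rw [preimage_sUnion]
      exact isOpen_biUnion fun U hU => (hS U hU).1 k
    · rintro ⟨U, hU, hpt⟩
      obtain ⟨N, hN⟩ := (hS U hU).2 hpt
      exact ⟨N, fun k hk x => ⟨U, hU, hN k hk x⟩⟩

theorem isOpen_iff {U : Set (NullSequence X)} : IsOpen U ↔
    (∀ k, IsOpen (inc k ⁻¹' U)) ∧ (pt ∈ U → ∃ N, ∀ k ≥ N, ∀ x, inc k x ∈ U) := Iff.rfl

theorem continuous_inc (k : ℕ) : Continuous (inc (X := X) k) :=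
  ⟨fun _ hU => hU.1 k⟩

theorem isOpen_image_inc (k : ℕ) {U : Set (X k)} (hU : IsOpen U) : IsOpen (inc k '' U) := by
  refine isOpen_iff.2 ⟨fun k' => ?_, ?_⟩
  · by_cases h : k' = k
    · subst h
      rwa [preimage_image_eq _ (inc_injective _)]
    · rw [preimage_inc_image_of_ne h]
      exact isOpen_empty
  · rintro ⟨x, -, hx⟩
    exact absurd hx (inc_ne_pt k x)

theorem isOpen_tail (N : ℕ) : IsOpen (tail N : Set (NullSequence X)) := by
  refine isOpen_iff.2 ⟨fun k => ?_, fun _ => ⟨N, fun k hk x => hk⟩⟩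
  by_cases h : N ≤ k
  · convert isOpen_univ
    exact eq_univ_of_forall fun x => h
  · convert isOpen_empty
    exact eq_empty_of_forall_notMem fun x => h

theorem isClosed_tail (N : ℕ) : IsClosed (tail N : Set (NullSequence X)) := by
  rw [← isOpen_compl_iff]
  refine isOpen_iff.2 ⟨fun k => ?_, fun h => absurd trivial h⟩
  by_cases h : N ≤ k
  · convert isOpen_empty
    exact eq_empty_of_forall_notMem fun x hx => hx h
  · convert isOpen_univ
    exact eq_univ_of_forall fun x => h

theorem exists_tail_of_isOpen {U : Set (NullSequence X)} (hU : IsOpen U) (h : pt ∈ U) :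
    ∃ N, ∀ k ≥ N, ∀ x, inc k x ∈ U := hU.2 h

theorem continuous_desc {Y : Type*} [TopologicalSpace Y] {y : Y} {g : ∀ k, X k → Y}
    (hg : ∀ k, Continuous (g k)) (hy : ∀ V ∈ 𝓝 y, ∃ N, ∀ k ≥ N, ∀ x, g k x ∈ V) :
    Continuous (desc y g) :=
  ⟨fun V hV => isOpen_iff.2 ⟨fun k => hV.preimage (hg k), fun h => hy V (hV.mem_nhds h)⟩⟩

theorem continuousOn_desc {Y : Type*} [TopologicalSpace Y] {y : Y} {g : ∀ k, X k → Y}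
    {A : Set (NullSequence X)} (hg : ∀ k, ContinuousOn (g k) (inc k ⁻¹' A))
    (hy : ∀ V ∈ 𝓝 y, ∃ N, ∀ k ≥ N, ∀ x, inc k x ∈ A → g k x ∈ V) :
    ContinuousOn (desc y g) A := by
  rw [continuousOn_iff']
  intro t ht
  choose u hu hut using fun k => continuousOn_iff'.1 (hg k) t ht
  have hut' : ∀ k x, inc k x ∈ A → (g k x ∈ t ↔ x ∈ u k) := by
    intro k x hx
    have := Set.ext_iff.1 (hut k) x
    simpa [hx] using this
  by_cases hyt : y ∈ t
  · obtain ⟨N, hN⟩ := hy t (ht.mem_nhds hyt)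
    refine ⟨tail N ∪ ⋃ k, inc k '' u k, (isOpen_tail N).union
      (isOpen_iUnion fun k => isOpen_image_inc k (hu k)), Set.ext fun z => ?_⟩
    revert z
    refine ind (by simp [hyt]) fun k x => and_congr_left fun hx => ?_
    rw [mem_preimage, desc_inc, hut' k x hx]
    constructor
    · exact fun h => Or.inr (mem_iUnion.2 ⟨k, mem_image_of_mem _ h⟩)
    · rintro (h | h)
      · exact (hut' k x hx).1 (hN k h x hx)
      · obtain ⟨k', x', hx', he⟩ := mem_iUnion.1 h
        cases inc_eq_inc_iff.1 he
        exact hx'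
  · refine ⟨⋃ k, inc k '' u k, isOpen_iUnion fun k => isOpen_image_inc k (hu k),
      Set.ext fun z => ?_⟩
    revert z
    refine ind ?_ fun k x => and_congr_left fun hx => ?_
    · refine and_congr_left fun _ => ⟨fun h => absurd h hyt, fun h => ?_⟩
      obtain ⟨k', x', -, he⟩ := mem_iUnion.1 h
      exact absurd he (inc_ne_pt _ _)
    · rw [mem_preimage, desc_inc, hut' k x hx]
      refine ⟨fun h => mem_iUnion.2 ⟨k, mem_image_of_mem _ h⟩, fun h => ?_⟩
      obtain ⟨k', x', hx', he⟩ := mem_iUnion.1 h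
      cases inc_eq_inc_iff.1 he
      exact hx'

instance [∀ k, T2Space (X k)] : T2Space (NullSequence X) := by
  have hpt : ∀ (k : ℕ) (x : X k), ∃ u v : Set (NullSequence X), IsOpen u ∧ IsOpen v ∧ pt ∈ u ∧
      inc k x ∈ v ∧ Disjoint u v := fun k x => by
    refine ⟨tail (k + 1), inc k '' univ, isOpen_tail _, isOpen_image_inc k isOpen_univ, by simp,
      mem_image_of_mem _ (mem_univ x), disjoint_left.2 ?_⟩
    rintro _ h ⟨y, -, rfl⟩
    rw [inc_mem_tail] at h
    omega
  refine ⟨fun z z' => ?_⟩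
  revert z
  refine ind ?_ fun k x => ?_ <;> revert z' <;> refine ind ?_ fun k' x' => ?_
  · exact fun h => absurd rfl h
  · exact fun _ => hpt k' x'
  · intro _
    obtain ⟨u, v, hu, hv, h1, h2, hd⟩ := hpt k x
    exact ⟨v, u, hv, hu, h2, h1, hd.symm⟩
  · intro hne
    by_cases hk : k = k'
    · subst hk
      obtain ⟨u, v, hu, hv, h1, h2, hd⟩ := t2_separation (fun h : x = x' => hne (by rw [h]))
      exact ⟨_, _, isOpen_image_inc k hu, isOpen_image_inc k hv, mem_image_of_mem _ h1,
        mem_image_of_mem _ h2, (disjoint_image_iff (inc_injective k)).2 hd⟩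
    · refine ⟨_, _, isOpen_image_inc k isOpen_univ, isOpen_image_inc k' isOpen_univ,
        mem_image_of_mem _ (mem_univ x), mem_image_of_mem _ (mem_univ x'), disjoint_left.2 ?_⟩
      rintro _ ⟨y, -, rfl⟩ ⟨y', -, he⟩
      exact hk (congrArg Sigma.fst (inc_eq_inc_iff.1 he)).symm

/-- A cover member around infinity swallows a tail; only finitely many pieces are left to refine. -/
instance [∀ k, ParacompactSpace (X k)] : ParacompactSpace (NullSequence X) := by
  refine ⟨fun α s hs hcov => ?_⟩
  obtain ⟨a₀, ha₀⟩ := mem_iUnion.1 (hcov ▸ mem_univ pt)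
  obtain ⟨N, hN⟩ := exists_tail_of_isOpen (hs a₀) ha₀
  choose v hvo hvc hvf hvs using fun k => precise_refinement (fun a => inc k ⁻¹' s a)
    (fun a => (hs a).1 k) (by rw [← preimage_iUnion, hcov, preimage_univ])
  refine ⟨Option (ℕ × α), fun b => b.elim (tail N) fun q => if q.1 < N then inc q.1 '' v q.1 q.2
    else ∅, ?_, ?_, ?_, ?_⟩
  · rintro (_ | ⟨k, a⟩)
    · exact isOpen_tail N
    · dsimp only [Option.elim]
      split_ifs
      · exact isOpen_image_inc k (hvo k a)
      · exact isOpen_empty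
  · refine eq_univ_of_forall (ind (mem_iUnion.2 ⟨none, pt_mem_tail N⟩) fun k x => ?_)
    by_cases hk : k < N
    · obtain ⟨a, ha⟩ := mem_iUnion.1 (hvc k ▸ mem_univ x)
      exact mem_iUnion.2 ⟨some (k, a), by simpa [hk] using mem_image_of_mem _ ha⟩
    · exact mem_iUnion.2 ⟨none, not_lt.1 hk⟩
  · refine ind ⟨tail N, (isOpen_tail N).mem_nhds (pt_mem_tail N), ?_⟩ fun k x => ?_
    · refine (finite_singleton none).subset ?_
      rintro (_ | ⟨k, a⟩) ⟨z, hz, hzN⟩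
      · rfl
      · dsimp only [Option.elim] at hz
        split_ifs at hz with hk
        · obtain ⟨x, -, rfl⟩ := hz
          exact absurd hk (not_lt.2 hzN)
        · exact hz.elim
    · obtain ⟨t, ht, hfin⟩ := hvf k x
      obtain ⟨t', ht', hto, hxt⟩ := mem_nhds_iff.1 ht
      refine ⟨inc k '' t', (isOpen_image_inc k hto).mem_nhds (mem_image_of_mem _ hxt), ?_⟩
      refine ((finite_singleton none).union (hfin.image fun a => some (k, a))).subset ?_
      rintro (_ | ⟨k', a⟩) ⟨z, hz, y, hy, rfl⟩
      · exact Or.inl rfl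
      · dsimp only [Option.elim] at hz
        split_ifs at hz with hk
        · obtain ⟨y', hy', he⟩ := hz
          cases inc_eq_inc_iff.1 he
          exact Or.inr ⟨a, ⟨y, hy', ht' hy⟩, rfl⟩
        · exact hz.elim
  · rintro (_ | ⟨k, a⟩)
    · exact ⟨a₀, ind (fun _ => ha₀) fun k x hk => hN k hk x⟩
    · refine ⟨a, ?_⟩
      dsimp only [Option.elim]
      split_ifs
      · exact image_subset_iff.2 (hvs k a)
      · exact empty_subset _

/-- Pieces can be extended over one by one; the issue is continuity at infinity. If infinity lies in
`A`, the values of `f` on a tail lie in a compact ENR, and Tietze extension followed by the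
retraction handles all but finitely many pieces at once. Otherwise `A` misses a tail, where a
constant serves. -/
theorem extDimLE [∀ k, T2Space (X k)] [∀ k, ParacompactSpace (X k)] {L : Type v}
    [TopologicalSpace L] [T2Space L] [Topology.CWComplex (univ : Set L)] [Nonempty L]
    (hX : ∀ k, ExtDimLE (X k) L) : ExtDimLE (NullSequence X) L := by
  classical
  refine .of_exists_eqOn fun A hA f hf => ?_
  have hAk : ∀ k, IsClosed (inc k ⁻¹' A) := fun k => hA.preimage (continuous_inc k)
  choose g hg using fun k => (hX k).exists_eqOn (hAk k)
    (hf.comp (continuous_inc k).continuousOn (mapsTo_preimage _ _))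
  by_cases hpt : pt ∈ A
  · have hT : ∀ V ∈ 𝓝 (f pt), ∃ N, ∀ k ≥ N, ∀ x, inc k x ∈ A → f (inc k x) ∈ V := by
      intro V hV
      obtain ⟨U, hU, hpU, hUV⟩ := mem_nhdsWithin.1 (hf pt hpt hV)
      obtain ⟨N, hN⟩ := exists_tail_of_isOpen hU hpU
      exact ⟨N, fun k hk x hx => hUV ⟨hN k hk x, hx⟩⟩
    obtain ⟨J₀, N₁, hJ₀⟩ := CWComplex.exists_forall_subset_cellUnion (p := f pt)
      (T := fun k => (fun x => f (inc k x)) '' (inc k ⁻¹' A)) (by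
        intro V hV
        obtain ⟨N, hN⟩ := hT V hV
        filter_upwards [Filter.eventually_ge_atTop N] with k hk
        rintro _ ⟨x, hx, rfl⟩
        exact hN k hk x hx)
    -- The cell of `f pt` is added by hand: the sets of nearby values may be empty and need not
    -- capture the limit.
    obtain ⟨γ, hγ⟩ := CWComplex.exists_mem_openCell (f pt)
    obtain ⟨J, hJ, -, Q, _, _, _, i, r, O, hi, hO, hiO, hr, -, hri⟩ :=
      CWComplex.exists_isCompactENR (insert γ J₀)
    have hpS : f pt ∈ CWComplex.cellUnion J :=
      mem_biUnion (hJ (Finset.mem_insert_self _ _) : γ ∈ _) hγ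
    have hS : MapsTo f (A ∩ tail N₁) (CWComplex.cellUnion J) := by
      rintro z ⟨hzA, hzN⟩
      revert z
      refine ind (fun _ _ => hpS) fun k x hx hk => ?_
      exact CWComplex.cellUnion_mono ((Finset.subset_insert _ _).trans hJ)
        (hJ₀ k hk ⟨x, hx, rfl⟩)
    obtain ⟨G, hG⟩ := (hA.inter (isClosed_tail N₁)).exists_continuousMap_eqOn
      (hi.comp (hf.mono inter_subset_left) hS)
    have hGpt : G pt = i (f pt) := hG ⟨hpt, pt_mem_tail _⟩
    have hGO : G pt ∈ O := hGpt ▸ hiO hpS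
    obtain ⟨N₂, hN₂⟩ := exists_tail_of_isOpen (hO.preimage G.continuous) hGO
    -- From `N₁` on, the values on `A` lie in the ENR; from `N₂` on, `G` stays in the domain `O` of
    -- the retraction.
    refine ⟨⟨desc (f pt) fun k x => if k < max N₁ N₂ then g k x else r (G (inc k x)),
      continuous_desc (fun k => ?_) ?_⟩, ?_⟩
    · split_ifs with hk
      · exact (g k).continuous
      · exact hr.comp_continuous (G.continuous.comp (continuous_inc k))
          fun x => hN₂ k (le_of_max_le_right (not_lt.1 hk)) x
    · intro V hV
      have hc : ContinuousAt (fun z => r (G z)) pt :=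
        (hr.continuousAt (hO.mem_nhds hGO)).comp G.continuous.continuousAt
      have hV' : (fun z => r (G z)) ⁻¹' V ∈ 𝓝 pt := hc (by simpa only [hGpt, hri _ hpS] using hV)
      obtain ⟨U, hUV, hU, hpU⟩ := mem_nhds_iff.1 hV'
      obtain ⟨N, hN⟩ := exists_tail_of_isOpen hU hpU
      refine ⟨max N (max N₁ N₂), fun k hk x => ?_⟩
      rw [if_neg (not_lt.2 (le_of_max_le_right hk))]
      exact hUV (hN k (le_of_max_le_left hk) x)
    · refine ind (fun _ => rfl) fun k x hx => ?_
      simp only [ContinuousMap.coe_mk, desc_inc]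
      split_ifs with hk
      · exact hg k hx
      · have hz : inc k x ∈ A ∩ tail N₁ := ⟨hx, le_of_max_le_left (not_lt.1 hk)⟩
        rw [hG hz, Function.comp_apply, hri _ (hS hz)]
  · obtain ⟨N, hN⟩ := exists_tail_of_isOpen hA.isOpen_compl hpt
    refine ⟨⟨desc (Classical.arbitrary L) fun k x => if k < N then g k x else Classical.arbitrary L,
      continuous_desc (fun k => ?_) ?_⟩, ?_⟩
    · split_ifs
      · exact (g k).continuous
      · exact continuous_const
    · intro V hV
      refine ⟨N, fun k hk x => ?_⟩
      rw [if_neg (not_lt.2 hk)]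
      exact mem_of_mem_nhds hV
    · refine ind (fun h => absurd h hpt) fun k x hx => ?_
      have hk : k < N := not_le.1 fun h => hN k h x hx
      simp only [ContinuousMap.coe_mk, desc_inc, if_pos hk]
      exact hg k hx

end NullSequence

section ExtensionNear

open Metric

/-! ### Local `[L]`-connectivity -/

section LocalConnectivity

variable {L : Type u} [TopologicalSpace L] {Y : Type v}

theorem IsExtConnectedPair.mono [TopologicalSpace Y] {V U V' U' : Set Y}
    (h : IsExtConnectedPair L V U) (hV : V' ⊆ V) (hU : U ⊆ U') : IsExtConnectedPair L V' U' := by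
  refine ⟨hV.trans (h.1.trans hU), fun X _ _ _ hX A hA f => ?_⟩
  obtain ⟨g, hg⟩ := h.2 X hX A hA ⟨fun a => inclusion hV (f a), by fun_prop⟩
  exact ⟨⟨fun x => inclusion hU (g x), by fun_prop⟩, hg⟩

theorem IsExtConnectedPair.exists_continuousOn_eqOn [Nonempty L] [TopologicalSpace Y] {V U : Set Y}
    (h : IsExtConnectedPair L V U) {X : Type u} [TopologicalSpace X] [T2Space X]
    [ParacompactSpace X] (hX : ExtDimLE X L) {S A : Set X} (hS : IsClosed S) (hA : IsClosed A)
    {f : X → Y} (hf : ContinuousOn f A) (hV : MapsTo f (S ∩ A) V) :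
    ∃ g : X → Y, ContinuousOn g S ∧ MapsTo g S U ∧ EqOn g f (S ∩ A) := by
  have := hS.isClosedEmbedding_subtypeVal.paracompactSpace
  obtain ⟨g, hgU, hg⟩ := h.exists_eqOn (hX.subtype hS) (hA.preimage continuous_subtype_val)
    (hf.comp continuous_subtype_val.continuousOn (mapsTo_preimage _ _))
    (fun x hx => hV ⟨x.2, hx⟩)
  have hext : ∀ a : S, Function.extend Subtype.val g f a = g a :=
    fun a => Subtype.val_injective.extend_apply _ _ a
  refine ⟨Function.extend Subtype.val g f, ?_, fun x hx => ?_, fun x hx => ?_⟩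
  · simpa using IsEmbedding.subtypeVal.continuousOn_image (B := univ) g.continuous.continuousOn
      (fun a _ => hext a)
  · rw [hext ⟨x, hx⟩]
    exact hgU _
  · rw [hext ⟨x, hx.1⟩]
    exact hg hx.2

/-- Metrizable `ANE([L])`-spaces are locally `[L]`-connected. -/
theorem IsANE.exists_isExtConnectedPair_ball [T2Space L] [Topology.CWComplex (univ : Set L)]
    [Nonempty L] [MetricSpace Y] (hY : IsANE L Y) (y : Y) {ε : ℝ} (hε : 0 < ε) :
    ∃ δ > 0, δ ≤ ε ∧ IsExtConnectedPair L (ball y δ) (ball y ε) := by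
  by_contra! hcon
  have : Nonempty Y := ⟨y⟩
  have hbad : ∀ k : ℕ, ∃ (X : Type u) (_ : TopologicalSpace X) (_ : T2Space X)
      (_ : ParacompactSpace X) (_ : ExtDimLE X L) (A : Set X) (_ : IsClosed A) (f : X → Y)
      (_ : ContinuousOn f A) (_ : MapsTo f A (ball y (ε / (k + 1)))),
      ∀ g : C(X, Y), (∀ x, g x ∈ ball y ε) → ¬ EqOn g f A := by
    intro k
    have hle : ε / (k + 1) ≤ ε := div_le_self hε.le (by simp)
    by_contra! hk
    refine hcon (ε / (k + 1)) (by positivity) hle (.of_exists_eqOn (ball_subset_ball hle) ?_)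
    exact fun X _ _ _ hX A hA f hf hV => hk X _ ‹_› ‹_› hX A hA f hf hV
  choose X tX hX2 hXp hX A hA f hf hfV hno using hbad
  -- The radii `ε / (k + 1)` tend to zero, so the counterexamples glue to a map continuous at
  -- infinity with value `y`. A neighbourhood extension stays in `ball y ε` on a whole piece `X N`,
  -- contradicting the choice of that piece.
  let A' : Set (NullSequence X) := NullSequence.desc True fun k x => x ∈ A k
  have hA' : IsClosed A' := by
    rw [← isOpen_compl_iff]
    exact NullSequence.isOpen_iff.2 ⟨fun k => (hA k).isOpen_compl, fun h => absurd trivial h⟩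
  have hf' : ContinuousOn (NullSequence.desc y f) A' := by
    refine NullSequence.continuousOn_desc hf fun V hV => ?_
    obtain ⟨η, hη, hηV⟩ := Metric.mem_nhds_iff.1 hV
    obtain ⟨N, hN⟩ := exists_nat_gt (ε / η)
    refine ⟨N, fun k hk x hx => hηV (ball_subset_ball ?_ (hfV k hx))⟩
    rw [div_le_iff₀ (by positivity)]
    rw [div_lt_iff₀ hη] at hN
    have : (N : ℝ) ≤ k := by exact_mod_cast hk
    nlinarith
  obtain ⟨O, g, hO, hAO, hg, hgf⟩ := hY.exists_eqOn (NullSequence.extDimLE hX) hA' hf'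
  have hpt : NullSequence.pt ∈ A' := trivial
  obtain ⟨N, hN⟩ := NullSequence.exists_tail_of_isOpen (hg.isOpen_inter_preimage hO isOpen_ball)
    (⟨hAO hpt, by rw [mem_preimage, hgf hpt]; exact mem_ball_self hε⟩ :
      NullSequence.pt ∈ O ∩ g ⁻¹' ball y ε)
  exact hno N ⟨fun x => g (NullSequence.inc N x), hg.comp_continuous
    (NullSequence.continuous_inc N) fun x => (hN N le_rfl x).1⟩ (fun x => (hN N le_rfl x).2)
    fun x hx => hgf (show NullSequence.inc N x ∈ A' from hx)

/-- A Lebesgue number argument; starting from `ε / 2` leaves room to move the centre. -/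
theorem IsANE.exists_forall_isExtConnectedPair_ball [T2Space L]
    [Topology.CWComplex (univ : Set L)] [Nonempty L] [MetricSpace Y] (hY : IsANE L Y) {C : Set Y}
    (hC : IsCompact C) {ε : ℝ} (hε : 0 < ε) :
    ∃ δ > 0, δ ≤ ε ∧ ∀ y ∈ C, IsExtConnectedPair L (ball y δ) (ball y ε) := by
  choose d hd hdε hpair using fun y => hY.exists_isExtConnectedPair_ball y (half_pos hε)
  obtain ⟨δ, hδ, hδC⟩ := lebesgue_number_lemma_of_metric hC (c := fun y => ball y (d y))
    (fun y => isOpen_ball) fun y _ => mem_iUnion.2 ⟨y, mem_ball_self (hd y)⟩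
  refine ⟨min δ ε, lt_min hδ hε, min_le_right _ _, fun y hy => ?_⟩
  obtain ⟨z, hz⟩ := hδC y hy
  have hyz : dist y z < ε / 2 := (mem_ball.1 (hz (mem_ball_self hδ))).trans_le (hdε z)
  refine (hpair z).mono ((ball_subset_ball (min_le_left _ _)).trans hz)
    (ball_subset_ball' ?_)
  rw [dist_comm] at hyz
  linarith

end LocalConnectivity

/-! ### Continuous maps near a discrete assignment -/

section MultipleCover

/-- The points lying in at least `k` of the sets `E i`. -/
def multiplicitySet {X ι : Type*} (E : ι → Set X) (k : ℕ) : Set X :=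
  ⋃ σ : {σ : Finset ι // σ.card = k}, ⋂ i ∈ σ.1, E i

variable {X ι : Type*} {E : ι → Set X}

theorem isClosed_multiplicitySet [TopologicalSpace X] [Finite ι] (hE : ∀ i, IsClosed (E i))
    (k : ℕ) : IsClosed (multiplicitySet E k) :=
  isClosed_iUnion_of_finite fun _ => isClosed_biInter fun i _ => hE i

theorem multiplicitySet_one : multiplicitySet E 1 = ⋃ i, E i := by
  refine Subset.antisymm (iUnion_subset fun σ => ?_) (iUnion_subset fun i => ?_)
  · obtain ⟨i, hi⟩ := Finset.card_eq_one.1 σ.2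
    rw [hi]
    simpa using subset_iUnion E i
  · exact (by simp : E i ⊆ ⋂ j ∈ ({i} : Finset ι), E j).trans
      (subset_iUnion (fun σ : {σ : Finset ι // σ.card = 1} => ⋂ j ∈ σ.1, E j) ⟨{i}, rfl⟩)

theorem mem_multiplicitySet_succ {k : ℕ} {σ τ : Finset ι} (hσ : σ.card = k) (hτ : τ.card = k)
    (hne : σ ≠ τ) {x : X} (hxσ : x ∈ ⋂ i ∈ σ, E i) (hxτ : x ∈ ⋂ i ∈ τ, E i) :
    x ∈ multiplicitySet E (k + 1) := by
  classical
  obtain ⟨i, hi, hiσ⟩ : ∃ i ∈ τ, i ∉ σ := by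
    by_contra! h
    exact hne (Finset.eq_of_subset_of_card_le h (by omega)).symm
  refine mem_iUnion.2 ⟨⟨insert i σ, by rw [Finset.card_insert_of_notMem hiσ, hσ]⟩, ?_⟩
  simp only [mem_iInter] at hxσ hxτ ⊢
  intro j hj
  rcases Finset.mem_insert.1 hj with rfl | hj
  · exact hxτ _ hi
  · exact hxσ j hj

end MultipleCover

section Approximation

variable {L : Type u} [TopologicalSpace L] {Y : Type v} [MetricSpace Y]

/-- Two distinct `k`-fold intersections meet only in points of multiplicity `k + 1`, where `g` is
already given; so the extensions over them are chosen independently and glue. Over each, values stay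
within `η` of one chosen centre, and the centres of other `U i` at the same point are within `δ` of
it, whence `δ + η ≤ ε`. -/
theorem exists_extension_multiplicitySet [Nonempty L] {C : Set Y} {δ η ε : ℝ}
    (hpair : ∀ y ∈ C, IsExtConnectedPair L (ball y δ) (ball y η)) (hδη : δ + η ≤ ε) (hη : 0 ≤ η)
    {X : Type u} [TopologicalSpace X] [T2Space X] [ParacompactSpace X] (hX : ExtDimLE X L)
    {A : Set X} (hA : IsClosed A) {ι : Type w} [Finite ι] {U E : ι → Set X} {c : ι → Y}
    (hc : ∀ i, c i ∈ C) (hcU : ∀ i j x, x ∈ U i → x ∈ U j → dist (c i) (c j) < δ)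
    (hE : ∀ i, IsClosed (E i)) (hEU : ∀ i, E i ⊆ U i) {k : ℕ} (hk : k ≠ 0) {g : X → Y}
    (hg : ContinuousOn g (A ∪ multiplicitySet E (k + 1)))
    (hgc : ∀ i, ∀ x ∈ A ∪ multiplicitySet E (k + 1), x ∈ U i → dist (g x) (c i) < δ) :
    ∃ g' : X → Y, ContinuousOn g' (A ∪ multiplicitySet E k) ∧ EqOn g' g A ∧
      ∀ i, ∀ x ∈ A ∪ multiplicitySet E k, x ∈ U i → dist (g' x) (c i) < ε := by
  classical
  set B : Set X := A ∪ multiplicitySet E (k + 1) with hB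
  have hBc : IsClosed B := hA.union (isClosed_multiplicitySet hE _)
  let I := {σ : Finset ι // σ.card = k}
  have hEσ : ∀ σ : I, IsClosed (⋂ i ∈ σ.1, E i) := fun σ => isClosed_biInter fun i _ => hE i
  have hne : ∀ σ : I, ∃ i, i ∈ σ.1 := fun σ =>
    Finset.card_pos.1 (by rw [σ.2]; exact Nat.pos_of_ne_zero hk)
  choose s hs using hne
  have hsU : ∀ (σ : I) x, x ∈ ⋂ i ∈ σ.1, E i → x ∈ U (s σ) := fun σ x hx =>
    hEU _ (mem_iInter₂.1 hx _ (hs σ))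
  choose h hh hhU hhg using fun σ : I =>
    (hpair (c (s σ)) (hc _)).exists_continuousOn_eqOn hX (hEσ σ) hBc hg
      fun x hx => hgc _ x hx.2 (hsU σ x hx.1)
  let g' : X → Y := fun x => if x ∈ B then g x else
    if hx : ∃ σ : I, x ∈ ⋂ i ∈ σ.1, E i then h hx.choose x else g x
  have hg'B : ∀ x ∈ B, g' x = g x := fun x hx => if_pos hx
  have hg'σ : ∀ σ : I, ∀ x ∈ ⋂ i ∈ σ.1, E i, g' x = h σ x := by
    intro σ x hx
    by_cases hxB : x ∈ B
    · rw [hg'B x hxB, hhg σ ⟨hx, hxB⟩]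
    · have hex : ∃ σ : I, x ∈ ⋂ i ∈ σ.1, E i := ⟨σ, hx⟩
      have heq : hex.choose = σ := by
        by_contra hcon
        exact hxB (Or.inr (mem_multiplicitySet_succ hex.choose.2 σ.2
          (fun h => hcon (Subtype.ext h)) hex.choose_spec hx))
      simp only [g', if_neg hxB, dif_pos hex, heq]
  refine ⟨g', ?_, fun x hx => hg'B x (Or.inl hx), ?_⟩
  · refine ContinuousOn.union_of_isClosed ((hg.mono subset_union_left).congr
      fun x hx => hg'B x (Or.inl hx)) ?_ hA (isClosed_multiplicitySet hE _)
    exact (locallyFinite_of_finite _).continuousOn_iUnion hEσ fun σ => (hh σ).congr (hg'σ σ)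
  · rintro i x (hx | hx) hxi
    · rw [hg'B x (Or.inl hx)]
      linarith [hgc i x (Or.inl hx) hxi]
    · obtain ⟨σ, hσ⟩ := mem_iUnion.1 hx
      rw [hg'σ σ x hσ]
      have h1 : dist (h σ x) (c (s σ)) < η := hhU σ hσ
      have h2 := hcU (s σ) i x (hsU σ x hσ) hxi
      linarith [dist_triangle (h σ x) (c (s σ)) (c i)]

variable [T2Space L] [Topology.CWComplex (univ : Set L)] [Nonempty L]

/-- Downward induction on the multiplicity `k`, with `j = n - k` steps remaining. It starts from the
empty set of points of multiplicity `n`, and fixes `δ` before the space and the cover are known. -/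
theorem IsANE.exists_extension_multiplicitySet (hY : IsANE L Y) {C : Set Y} (hC : IsCompact C)
    (n j k : ℕ) (hk : k ≠ 0) (hkj : k + j = n) {ε : ℝ} (hε : 0 < ε) :
    ∃ δ > 0, ∀ (X : Type u) [TopologicalSpace X] [T2Space X] [ParacompactSpace X], ExtDimLE X L →
      ∀ (A : Set X) (f : X → Y) (ι : Type w) [Finite ι] (U E : ι → Set X) (c : ι → Y),
        IsClosed A → ContinuousOn f A → (∀ i, c i ∈ C) →
        (∀ i j x, x ∈ U i → x ∈ U j → dist (c i) (c j) < δ) →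
        (∀ i, ∀ x ∈ A, x ∈ U i → dist (f x) (c i) < δ) →
        (∀ i, IsClosed (E i)) → (∀ i, E i ⊆ U i) → multiplicitySet E n = ∅ →
        ∃ g : X → Y, ContinuousOn g (A ∪ multiplicitySet E k) ∧ EqOn g f A ∧
          ∀ i, ∀ x ∈ A ∪ multiplicitySet E k, x ∈ U i → dist (g x) (c i) < ε := by
  induction j generalizing k ε with
  | zero =>
    refine ⟨ε, hε, fun X _ _ _ _ A f ι _ U E c _ hf _ _ hfc _ _ hn => ⟨f, ?_, fun _ _ => rfl, ?_⟩⟩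
    · rwa [show k = n from hkj, hn, union_empty]
    · rw [show k = n from hkj, hn, union_empty]
      exact hfc
  | succ j ih =>
    obtain ⟨δ₁, hδ₁, hδε, hpair⟩ := hY.exists_forall_isExtConnectedPair_ball hC (half_pos hε)
    obtain ⟨δ₂, hδ₂, hext⟩ := ih (k + 1) (Nat.succ_ne_zero k) (by omega) hδ₁
    refine ⟨min δ₁ δ₂, lt_min hδ₁ hδ₂, fun X _ _ _ hX A f ι _ U E c hA hf hc hcU hfc hE hEU hn => ?_⟩
    obtain ⟨g, hg, hgf, hgc⟩ := hext X hX A f ι U E c hA hf hc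
      (fun i j x hi hj => (hcU i j x hi hj).trans_le (min_le_right _ _))
      (fun i x hx hi => (hfc i x hx hi).trans_le (min_le_right _ _)) hE hEU hn
    obtain ⟨g', hg', hgg', hgc'⟩ := _root_.exists_extension_multiplicitySet (ε := ε) hpair
      (by linarith) (half_pos hε).le hX hA hc
      (fun i j x hi hj => (hcU i j x hi hj).trans_le (min_le_left _ _)) hE hEU hk hg hgc
    exact ⟨g', hg', hgg'.trans hgf, hgc'⟩

/-- Given a finite open cover of a space `X` with `e-dim X ≤ [L]` and points near a compact set
assigned to its members, there is a continuous map close to this assignment, extending a given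
partial map that is already close to it. -/
theorem IsANE.exists_extension_near_cover {n : ℕ}
    (hL : ExtTypeLE L (sphere (0 : EuclideanSpace ℝ (Fin (n + 1))) 1)) (hY : IsANE L Y)
    {C : Set Y} (hC : IsCompact C) {ε : ℝ} (hε : 0 < ε) :
    ∃ δ > 0, ∀ (X : Type u) [TopologicalSpace X] [T2Space X] [ParacompactSpace X], ExtDimLE X L →
      ∀ (A : Set X) (f : X → Y) (ι : Type w) [Finite ι] (U : ι → Set X) (c : ι → Y),
        IsClosed A → ContinuousOn f A → (∀ i, IsOpen (U i)) → ⋃ i, U i = univ → (∀ i, c i ∈ C) →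
        (∀ i j x, x ∈ U i → x ∈ U j → dist (c i) (c j) < δ) →
        (∀ i, ∀ x ∈ A, x ∈ U i → dist (f x) (c i) < δ) →
        ∃ g : C(X, Y), EqOn g f A ∧ ∀ i x, x ∈ U i → dist (g x) (c i) < ε := by
  -- No point has multiplicity `n + 2`; after `n + 1` steps multiplicity one is reached, which
  -- covers all of `X`.
  obtain ⟨δ, hδ, h⟩ := hY.exists_extension_multiplicitySet.{u, v, w} hC (n + 2) (n + 1) 1
    one_ne_zero (by omega) hε
  refine ⟨δ, hδ, fun X _ _ _ hX A f ι _ U c hA hf hU hcov hc hcU hfc => ?_⟩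
  obtain ⟨E, hE, hEU, hEcov, hEn⟩ := (hL X hX).exists_isClosed_cover U hU hcov
  obtain ⟨g, hg, hgf, hgc⟩ := h X hX A f ι U E c hA hf hc hcU hfc hE hEU
    (iUnion_eq_empty.2 fun σ => hEn σ.1 σ.2)
  rw [multiplicitySet_one, hEcov, union_univ] at hg hgc
  exact ⟨⟨g, continuousOn_univ.1 hg⟩, hgf, fun i x hx => hgc i x (mem_univ x) hx⟩

end Approximation

/-! ### Transfer between two embeddings -/

theorem Topology.IsEmbedding.exists_dist_lt_of_compactSpace {M X Y : Type*} [TopologicalSpace M]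
    [CompactSpace M] [MetricSpace X] [MetricSpace Y] {i : M → X} {j : M → Y} (hi : IsEmbedding i)
    (hj : Continuous j) {ε : ℝ} (hε : 0 < ε) :
    ∃ δ > 0, ∀ m m', dist (i m) (i m') < δ → dist (j m) (j m') < ε := by
  let _ := hi.comapMetricSpace i
  obtain ⟨δ, hδ, h⟩ :=
    Metric.uniformContinuous_iff.1 (CompactSpace.uniformContinuous_of_continuous hj) ε hε
  exact ⟨δ, hδ, fun m m' hm => h hm⟩

theorem IsCompact.exists_finset_dist_lt {M Y : Type*} [TopologicalSpace M] [MetricSpace Y]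
    {S : Set M} (hS : IsCompact S) {j : M → Y} (hj : Continuous j) {r : ℝ} (hr : 0 < r) :
    ∃ t : Finset M, (∀ m ∈ t, m ∈ S) ∧ ∀ x ∈ S, ∃ m ∈ t, dist (j x) (j m) < r := by
  obtain ⟨t, htS, ht⟩ := hS.elim_nhds_subcover (fun m => j ⁻¹' ball (j m) r)
    fun m _ => hj.continuousAt (ball_mem_nhds _ hr)
  refine ⟨t, htS, fun x hx => ?_⟩
  obtain ⟨m, hm, hxm⟩ := mem_iUnion₂.1 (ht hx)
  exact ⟨m, hm, hxm⟩

theorem exists_thickening_subset_of_mem_nhdsSet {Y : Type*} [MetricSpace Y] {K U : Set Y}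
    (hK : IsCompact K) (hU : U ∈ 𝓝ˢ K) : ∃ ε > 0, thickening ε K ⊆ U := by
  obtain ⟨V, hV, hKV, hVU⟩ := mem_nhdsSet_iff_exists.1 hU
  obtain ⟨ε, hε, h⟩ := hK.exists_thickening_subset_open hV hKV
  exact ⟨ε, hε, h.trans hVU⟩

/-- Transfer of `UV^[L]`-connectedness between embeddings of a compact space into metric
`ANE([L])`-spaces. -/
theorem IsUVConnectedPair.of_isEmbedding {L : Type u} [TopologicalSpace L] [T2Space L]
    [Topology.CWComplex (univ : Set L)] [Nonempty L] {n : ℕ}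
    (hL : ExtTypeLE L (sphere (0 : EuclideanSpace ℝ (Fin (n + 1))) 1))
    {M : Type v} [TopologicalSpace M] [CompactSpace M] [Nonempty M] {K : Set M} (hK : IsCompact K)
    {B : Type w} [MetricSpace B] {i : M → B} (hB : IsANE L B) (hi : IsEmbedding i)
    (hUV : IsUVConnectedPair L (i '' K) (range i)) {Y : Type w'} [MetricSpace Y] (hY : IsANE L Y)
    {j : M → Y} (hj : IsEmbedding j) : IsUVConnectedPair L (j '' K) (range j) := by
  have : Nonempty Y := .map j inferInstance
  have : Nonempty B := .map i inferInstance
  have hCi : IsCompact (range i) := isCompact_range hi.continuous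
  have hCj : IsCompact (range j) := isCompact_range hj.continuous
  refine ⟨image_subset_range _ _, fun U hU => ?_⟩
  -- The constants are chosen backwards along the route from `Y` to `B` and back, starting from the
  -- target `U`.
  obtain ⟨ε, hε, hεU⟩ := exists_thickening_subset_of_mem_nhdsSet hCj hU
  obtain ⟨δ, hδ, hextY⟩ := hY.exists_extension_near_cover.{u, w', v} hL hCj hε
  obtain ⟨η, hη, hij⟩ := hi.exists_dist_lt_of_compactSpace hj.continuous (half_pos hδ)
  have hη4 : 0 < η / 4 := by positivity
  obtain ⟨W', hW', hW⟩ := hUV.2 (thickening (η / 4) (range i))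
    (isOpen_thickening.mem_nhdsSet.2 (self_subset_thickening hη4 _))
  obtain ⟨ε', hε', hεW⟩ :=
    exists_thickening_subset_of_mem_nhdsSet (hK.image hi.continuous) hW'
  -- Closeness `ε'` puts the transferred map in `W'`; closeness `η / 4` serves to compare it with
  -- `f` on the way back.
  obtain ⟨δ', hδ', hextB⟩ :=
    hB.exists_extension_near_cover.{u, w, v} hL hCi (lt_min hε' hη4)
  obtain ⟨θ, hθ, hji⟩ := hj.exists_dist_lt_of_compactSpace hi.continuous hδ'
  -- Centres whose `2ρ`-balls share a point are less than `4ρ ≤ θ` apart; `2ρ ≤ δ / 2` is half the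
  -- error allowed on `A`; `ρ ≤ ε` gives `V ⊆ U`.
  obtain ⟨ρ, hρ, hρθ, hρδ, hρε⟩ : ∃ ρ > 0, 4 * ρ ≤ θ ∧ 4 * ρ ≤ δ ∧ ρ ≤ ε :=
    ⟨min (θ / 4) (min (δ / 4) ε), by positivity,
      by linarith [min_le_left (θ / 4) (min (δ / 4) ε)],
      by linarith [min_le_right (θ / 4) (min (δ / 4) ε), min_le_left (δ / 4) ε],
      (min_le_right _ _).trans (min_le_right _ _)⟩
  refine ⟨thickening ρ (j '' K),
    isOpen_thickening.mem_nhdsSet.2 (self_subset_thickening hρ _), .of_exists_eqOn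
      ((thickening_mono hρε _).trans ((thickening_subset_of_subset _
        (image_subset_range _ _)).trans hεU)) fun X _ _ _ hX A hA f hf hfV => ?_⟩
  -- transfer `f` to `B`
  obtain ⟨t, htK, ht⟩ := hK.exists_finset_dist_lt hj.continuous hρ
  have := hA.isClosedEmbedding_subtypeVal.paracompactSpace
  have hfA : Continuous fun a : A => f a := hf.domRestrict
  have hnear : ∀ a : A, ∃ m ∈ t, dist (f a) (j m) < 2 * ρ := by
    intro a
    obtain ⟨_, ⟨m, hm, rfl⟩, hfm⟩ := mem_thickening_iff.1 (hfV a.2)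
    obtain ⟨m', hm', hmm⟩ := ht m hm
    exact ⟨m', hm', by linarith [dist_triangle (f a) (j m) (j m')]⟩
  -- The space is `A` itself and nothing is prescribed. The centres come from `K`, so `q` lands near
  -- `i(K)`.
  obtain ⟨q, -, hq⟩ := hextB A (hX.subtype hA) ∅ (fun _ => Classical.arbitrary B) t
    (fun m => (fun a : A => f a) ⁻¹' ball (j m) (2 * ρ)) (fun m => i m) isClosed_empty
    (continuousOn_empty _) (fun m => isOpen_ball.preimage hfA) (by
      refine eq_univ_of_forall fun a => ?_
      obtain ⟨m, hm, h⟩ := hnear a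
      exact mem_iUnion.2 ⟨⟨m, hm⟩, h⟩)
    (fun m => mem_range_self _) (fun m m' a h h' => hji _ _ (by
      have h1 : dist (f a) (j m) < 2 * ρ := h
      have h2 : dist (f a) (j m') < 2 * ρ := h'
      linarith [dist_triangle_left (j m) (j m') (f a)])) (fun _ _ h => h.elim)
  obtain ⟨q', hq', hqq'⟩ := q.exists_continuousOn_eq
  obtain ⟨G, hGW, hGq⟩ := hW.exists_eqOn hX hA hq' (fun a ha => hεW (by
    obtain ⟨m, hm, h⟩ := hnear ⟨a, ha⟩
    rw [hqq' ⟨a, ha⟩]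
    exact mem_thickening_iff.2 ⟨i m, mem_image_of_mem _ (htK m hm),
      (hq ⟨m, hm⟩ ⟨a, ha⟩ h).trans_le (min_le_left _ _)⟩))
  -- transfer the extension back to `Y`
  obtain ⟨s, -, hs⟩ := (isCompact_univ (X := M)).exists_finset_dist_lt hi.continuous hη4
  have hcov : ∀ x, ∃ m ∈ s, dist (G x) (i m) < η / 2 := by
    intro x
    obtain ⟨_, ⟨m, rfl⟩, hm⟩ := mem_thickening_iff.1 (hGW x)
    obtain ⟨m', hm', hmm⟩ := hs m (mem_univ m)
    exact ⟨m', hm', by linarith [dist_triangle (G x) (i m) (i m')]⟩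
  obtain ⟨g, hgf, hg⟩ := hextY X hX A f s (fun m => G ⁻¹' ball (i m) (η / 2)) (fun m => j m) hA hf
    (fun m => isOpen_ball.preimage G.continuous) (by
      refine eq_univ_of_forall fun x => ?_
      obtain ⟨m, hm, h⟩ := hcov x
      exact mem_iUnion.2 ⟨⟨m, hm⟩, h⟩)
    (fun m => mem_range_self _) (fun m m' x h h' => (hij _ _ (by
      have h1 : dist (G x) (i m) < η / 2 := h
      have h2 : dist (G x) (i m') < η / 2 := h'
      linarith [dist_triangle_left (i m) (i m') (G x)])).trans (by linarith)) (by
      -- `G a = q a` is near both `i m` and `i m'`, so `j m` and `j m'` are within `δ / 2`, while `f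
      -- a` is within `2ρ ≤ δ / 2` of `j m'`.
      intro m a ha h
      obtain ⟨m', hm', hfm⟩ := hnear ⟨a, ha⟩
      have h1 : dist (G a) (i m) < η / 2 := h
      have h2 : dist (q ⟨a, ha⟩) (i m') < η / 4 :=
        (hq ⟨m', hm'⟩ ⟨a, ha⟩ hfm).trans_le (min_le_right _ _)
      rw [hGq ha, hqq' ⟨a, ha⟩] at h1
      have h3 := hij m' m (by linarith [dist_triangle_left (i m') (i m) (q ⟨a, ha⟩)])
      have h4 : dist (f a) (j m') < 2 * ρ := hfm
      linarith [dist_triangle (f a) (j m') (j m)])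
  refine ⟨g, fun x => hεU ?_, hgf⟩
  obtain ⟨m, hm, h⟩ := hcov x
  exact mem_thickening_iff.2 ⟨j m, mem_range_self _, hg ⟨m, hm⟩ x h⟩

end ExtensionNear

theorem mainTheorem12
    {L : Type u} [TopologicalSpace L] [T2Space L] [CWComplex (univ : Set L)]
    (hL : ∃ n : ℕ, ExtTypeLE L (Metric.sphere (0 : EuclideanSpace ℝ (Fin (n + 1))) 1))
    {M : Type v} [TopologicalSpace M] [CompactSpace M] {K : Set M} (hK : IsCompact K)
    (hUV : ∃ (B : Type w) (_ : TopologicalSpace B) (_ : PolishSpace B) (i : M → B),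
      IsANE L B ∧ IsEmbedding i ∧ IsUVConnectedPair L (i '' K) (range i)) :
    ∀ (Y : Type w') [TopologicalSpace Y] [PolishSpace Y], IsANE L Y →
      ∀ j : M → Y, IsEmbedding j → IsUVConnectedPair L (j '' K) (range j) := by
  obtain ⟨n, hL⟩ := hL
  obtain ⟨B, _, _, i, hB, hi, hUV⟩ := hUV
  intro Y _ _ hY j hj
  rcases isEmpty_or_nonempty L with hLe | hLn
  · refine ⟨image_subset_range _ _, fun U hU =>
      ⟨U, nhdsSet_mono (image_subset_range _ _) hU, Subset.rfl, fun X _ _ _ hX A hA f => ?_⟩⟩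
    have := hX.isEmpty
    exact ⟨⟨isEmptyElim, by fun_prop⟩, fun a => isEmptyElim (a : X)⟩
  rcases isEmpty_or_nonempty M with hMe | hMn
  · have hr : range i = ∅ := range_eq_empty i
    -- With `M` empty the hypothesis is contradictory: `∅` is a neighbourhood of `range i`, and the
    -- empty partial map on a one-point space would extend to a map into `∅`.
    obtain ⟨V, -, hV⟩ := hUV.2 ∅ (by rw [hr]; simp)
    have hpt : ExtDimLE PUnit.{u + 1} L := .of_exists_eqOn fun A _ f _ =>
      ⟨⟨f, continuous_of_discreteTopology⟩, fun _ _ => rfl⟩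
    obtain ⟨g, -⟩ := hV.2 PUnit.{u + 1} hpt ∅ isClosed_empty
      ⟨fun a => a.2.elim, continuous_of_discreteTopology⟩
    exact (g PUnit.unit).2.elim
  let _ := TopologicalSpace.metrizableSpaceMetric B
  let _ := TopologicalSpace.metrizableSpaceMetric Y
  exact IsUVConnectedPair.of_isEmbedding hL hK hB hi hUV hY hj
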